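/- Let $m\ge 1$, $n\ge 2$, let $E=(d_{kl})$ be a real $m\times m$ matrix, let $F:\mathbb{R}^m\to\mathbb{R}^m$ be $C^1$, and let $\phi$ be a periodic solution, with minimum period $p>0$, of the kinetic system $\dot U=F(U)$. Write $J(t)=F_U(\phi(t))$, and assume that the Floquet multipliers $\gamma_1,\dots,\gamma_m$ of $\dot U=J(t)U$ over the period $p$ (the eigenvalues of its monodromy matrix, with algebraic multiplicity) satisfy $\gamma_1=1$ and $|\gamma_2|<1,\dots,|\gamma_m|<1$. Let $\phi_\epsilon$, $|\epsilon|<\epsilon_0$, be a family of periodic solutions of the perturbed systems $(I_m+\epsilon E)\dot U=F(U)$ bifurcating from $\phi$, with period function $P$; that is, $\phi_\epsilon$ has minimum period $P(\epsilon)$, $\phi_0=\phi$, and $\epsilon\mapsto\phi_\epsilon(t)$ (for each $t$) and $\epsilon\mapsto P(\epsilon)$ are continuous at $\epsilon=0$. Then $P$ is differentiable at $0$. For $\delta\ge 0$ consider the $n$-patch model $$\dot u_k^{(j)}=\delta\sum_{l=1}^m\sum_{i=1}^n d_{kl}\bigl(u_l^{(i)}-u_l^{(j)}\bigr)+f_k\bigl(u_1^{(j)},\dots,u_m^{(j)}\bigr),\qquad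 1\le k\le m,\ 1\le j\le n,$$ where $F=(f_1,\dots,f_m)^T$, and its linearization about the synchronous solution $(\phi,\dots,\phi)$. There are $\delta_0>0$, $r>0$ and $C$ such that for every $\delta\in[0,\delta_0)$ this linearization has, counted with algebraic multiplicity over the period $p$, $n$ Floquet multipliers $\gamma_1(\delta),\dots,\gamma_n(\delta)\in\mathbb{C}$ with $$\gamma_1(\delta)=1,\qquad \bigl|\gamma_j(\delta)-\bigl(1-nP'(0)\delta\bigr)\bigr|\le C\delta^2\quad (j=2,\dots,n),$$ while all its other Floquet multipliers $\mu$ satisfy $|\mu-1|\ge r$. -/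

import Mathlib

/-- `p` is the minimum period of `u`: the least positive period. A constant function has none. -/
def IsMinPeriod {α : Type*} (u : ℝ → α) (p : ℝ) : Prop :=
  IsLeast {q : ℝ | 0 < q ∧ Function.Periodic u q} p

/-- The Jacobian matrix of a vector field `G` on `ℝ^ι` at `x`. -/
noncomputable def jacobian {ι : Type*} [Fintype ι] [DecidableEq ι]
    (G : (ι → ℝ) → (ι → ℝ)) (x : ι → ℝ) : Matrix ι ι ℝ :=
  LinearMap.toMatrix' (fderiv ℝ G x : (ι → ℝ) →ₗ[ℝ] (ι → ℝ))

/-- `Φ` is the principal fundamental matrix solution of the linear system `Y' = A(t) Y`: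
`Φ(0) = I` and `Φ'(t) = A(t) Φ(t)` (entrywise). -/
def IsPrincipalFundamentalMatrix {ι : Type*} [Fintype ι] [DecidableEq ι]
    (A Φ : ℝ → Matrix ι ι ℝ) : Prop :=
  Φ 0 = 1 ∧ ∀ t i k, HasDerivAt (fun s => Φ s i k) ((A t * Φ t) i k) t

/-- `M` is the multiset of Floquet multipliers of the `T`-periodic linear system `Y' = A(t) Y`:
the system has a principal fundamental matrix solution `Φ`, and `M` consists of the complex
eigenvalues of the monodromy matrix `Φ(T)`, with algebraic multiplicity. -/
def HasFloquetMultipliers {ι : Type*} [Fintype ι] [DecidableEq ι]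
    (A : ℝ → Matrix ι ι ℝ) (T : ℝ) (M : Multiset ℂ) : Prop :=
  ∃ Φ : ℝ → Matrix ι ι ℝ, IsPrincipalFundamentalMatrix A Φ ∧
    ((Φ T).map (algebraMap ℝ ℂ)).charpoly.roots = M

/-- The right-hand side of the `n`-patch model with kinetics `F`, coupling matrix `E = (d_{kl})` and
coupling strength `δ`. The coordinate `(j, k)` is the `k`-th species in the `j`-th patch. -/
def patchField {m : ℕ} (n : ℕ) (E : Matrix (Fin m) (Fin m) ℝ)
    (F : (Fin m → ℝ) → (Fin m → ℝ)) (δ : ℝ) :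
    (Fin n × Fin m → ℝ) → (Fin n × Fin m → ℝ) :=
  fun U p => δ * ∑ l : Fin m, ∑ i : Fin n, E p.2 l * (U (i, l) - U (p.1, l))
    + F (fun l => U (p.1, l)) p.2

/-- The synchronous state all of whose `n` patches are in the state `x`. -/
def synchronous {m : ℕ} (n : ℕ) (x : Fin m → ℝ) : Fin n × Fin m → ℝ :=
  fun p => x p.2

/-- The coefficient matrix of the linearization of the patch model about the synchronous function
`t ↦ (φ(t), …, φ(t))`. -/
noncomputable def patchLinearization {m : ℕ} (n : ℕ) (E : Matrix (Fin m) (Fin m) ℝ)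
    (F : (Fin m → ℝ) → (Fin m → ℝ)) (φ : ℝ → Fin m → ℝ) (δ : ℝ) :
    ℝ → Matrix (Fin n × Fin m) (Fin n × Fin m) ℝ :=
  fun t => jacobian (patchField n E F δ) (synchronous n (φ t))

/-- The block matrix with diagonal blocks `(n - 1) E` and off-diagonal blocks `-E`. -/
def couplingMatrix {m : ℕ} (n : ℕ) (E : Matrix (Fin m) (Fin m) ℝ) :
    Matrix (Fin n × Fin m) (Fin n × Fin m) ℝ :=
  Matrix.of fun p q => if p.1 = q.1 then ((n : ℝ) - 1) * E p.2 q.2 else -E p.2 q.2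

/-- The linearization has the block form `-δ 𝓔 + diag(J(t), …, J(t))`, `J(t) = F_U(φ(t))`. -/
theorem patchLinearization_eq {m : ℕ} (n : ℕ) (E : Matrix (Fin m) (Fin m) ℝ)
    (F : (Fin m → ℝ) → (Fin m → ℝ)) (hF : Differentiable ℝ F) (φ : ℝ → Fin m → ℝ) (δ t : ℝ) :
    patchLinearization n E F φ δ t = -δ • couplingMatrix n E +
      Matrix.of (fun p q : Fin n × Fin m =>
        if p.1 = q.1 then jacobian F (φ t) p.2 q.2 else 0) := by
  have hpr : ∀ j : Fin n, HasFDerivAt (fun (U : Fin n × Fin m → ℝ) (l : Fin m) => U (j, l))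
      (ContinuousLinearMap.pi fun l => ContinuousLinearMap.proj (j, l))
      (synchronous n (φ t)) := fun j =>
    (ContinuousLinearMap.pi fun l : Fin m =>
      (ContinuousLinearMap.proj (R := ℝ) (φ := fun _ : Fin n × Fin m => ℝ) (j, l))).hasFDerivAt
  have hco : ∀ q : Fin n × Fin m, HasFDerivAt (fun (U : Fin n × Fin m → ℝ) => U q)
      (ContinuousLinearMap.proj q) (synchronous n (φ t)) := fun q =>
    (ContinuousLinearMap.proj (R := ℝ) (φ := fun _ : Fin n × Fin m => ℝ) q).hasFDerivAt
  have hFd : ∀ j : Fin n, HasFDerivAt F (fderiv ℝ F (φ t))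
      ((fun (U : Fin n × Fin m → ℝ) (l : Fin m) => U (j, l)) (synchronous n (φ t))) :=
    fun j => (hF (φ t)).hasFDerivAt
  have key : HasFDerivAt (patchField n E F δ) (ContinuousLinearMap.pi fun p : Fin n × Fin m =>
      δ • ∑ l : Fin m, ∑ i : Fin n, E p.2 l • (ContinuousLinearMap.proj (R := ℝ)
        (φ := fun _ : Fin n × Fin m => ℝ) (i, l) - ContinuousLinearMap.proj (p.1, l))
      + (ContinuousLinearMap.proj p.2).comp ((fderiv ℝ F (φ t)).comp
        (ContinuousLinearMap.pi fun l => ContinuousLinearMap.proj (p.1, l))))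
      (synchronous n (φ t)) := by
    refine hasFDerivAt_pi.2 fun p => HasFDerivAt.add ?_ ?_
    · refine HasFDerivAt.const_mul (HasFDerivAt.fun_sum fun l _ =>
        HasFDerivAt.fun_sum fun i _ => ?_) δ
      exact ((hco (i, l)).sub (hco (p.1, l))).const_mul (E p.2 l)
    · exact (hasFDerivAt_pi'.1 ((hFd p.1).comp _ (hpr p.1)) p.2)
  ext ⟨j, k⟩ ⟨i, l⟩
  rw [patchLinearization, jacobian, key.fderiv, LinearMap.toMatrix'_apply]
  have hs : (fun l' : Fin m => (Pi.single (i, l) (1 : ℝ) : Fin n × Fin m → ℝ) (j, l')) =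
      if j = i then Pi.single l 1 else 0 := by
    ext l'
    by_cases h : j = i <;> simp [Pi.single_apply, h]
  have hsum : ∑ l' : Fin m, ∑ i' : Fin n, E k l' *
      ((Pi.single (i, l) (1 : ℝ) : Fin n × Fin m → ℝ) (i', l')
        - (Pi.single (i, l) (1 : ℝ) : Fin n × Fin m → ℝ) (j, l')) =
      E k l - if j = i then n * E k l else 0 := by
    by_cases h : j = i <;>
      simp [Pi.single_apply, h, mul_sub, Finset.sum_sub_distrib, ite_and]
  have hval : ∀ v : Fin n × Fin m → ℝ, (ContinuousLinearMap.pi fun p : Fin n × Fin m =>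
      δ • ∑ l : Fin m, ∑ i : Fin n, E p.2 l • (ContinuousLinearMap.proj (R := ℝ)
        (φ := fun _ : Fin n × Fin m => ℝ) (i, l) - ContinuousLinearMap.proj (p.1, l))
      + (ContinuousLinearMap.proj p.2).comp ((fderiv ℝ F (φ t)).comp
        (ContinuousLinearMap.pi fun l => ContinuousLinearMap.proj (p.1, l)))) v (j, k) =
      δ * ∑ l' : Fin m, ∑ i' : Fin n, E k l' * (v (i', l') - v (j, l'))
        + fderiv ℝ F (φ t) (fun l' => v (j, l')) k := by
    intro v
    simp only [ContinuousLinearMap.coe_pi', add_apply,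
      smul_apply, sum_apply,
      sub_apply, ContinuousLinearMap.proj_apply, smul_eq_mul]
    rfl
  rw [ContinuousLinearMap.coe_coe, hval, hs, hsum]
  by_cases h : j = i
  · simp [jacobian, couplingMatrix, LinearMap.toMatrix'_apply, h]
    ring
  · simp [jacobian, couplingMatrix, h]

/-- `u` solves the perturbed kinetic system `(I + ε E) U' = F(U)` on the whole line. -/
def IsPerturbedSolution {m : ℕ} (E : Matrix (Fin m) (Fin m) ℝ)
    (F : (Fin m → ℝ) → (Fin m → ℝ)) (ε : ℝ) (u : ℝ → Fin m → ℝ) : Prop :=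
  ∀ t, ∃ v : Fin m → ℝ, HasDerivAt u v t ∧ (1 + ε • E).mulVec v = F (u t)

/-- `ψ ε`, `|ε| < ε₀`, is a family of periodic solutions of the perturbed kinetic systems
`(I + ε E) U' = F(U)` bifurcating from `φ` at `ε = 0`, and `P` is its period function:
`P ε` is the minimum period of `ψ ε`. Nothing but continuity at `ε = 0` is asked for the dependence
on `ε`. -/
structure IsBifurcatingFamily {m : ℕ} (E : Matrix (Fin m) (Fin m) ℝ)
    (F : (Fin m → ℝ) → (Fin m → ℝ)) (φ : ℝ → Fin m → ℝ) (ε₀ : ℝ)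
    (ψ : ℝ → ℝ → Fin m → ℝ) (P : ℝ → ℝ) : Prop where
  pos : 0 < ε₀
  solution : ∀ ε, |ε| < ε₀ → IsPerturbedSolution E F ε (ψ ε)
  minPeriod : ∀ ε, |ε| < ε₀ → IsMinPeriod (ψ ε) (P ε)
  at_zero : ψ 0 = φ
  continuousAt : ∀ t, ContinuousAt (fun ε => ψ ε t) 0
  continuousAt_period : ContinuousAt P 0

/-! Let `A = Φ p` be the monodromy matrix of the kinetic system, `v = F (φ 0)` its eigenvector for
the multiplier 1, and `w` the left eigenvector; simplicity of the multiplier means `w ⬝ᵥ v ≠ 0`.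

The patch average is a rank-one projection `Q`. The coupling vanishes on its range and acts as `n E`
on the complement, so the linearized patch model has fundamental matrix `Q ⊗ Φ + (1 - Q) ⊗ Ψ`, with
`Ψ` the fundamental matrix of `Y' = (J - η E) Y` at `η = n δ`. By `charpoly_kronecker_projection`
its multipliers are those of `A` once and those of `Ψ p` taken `n - 1` times.

Variation of constants with a Dyson series gives `Ψ p = A + η A D(p) + O(η²)`, where `D' = -Φ⁻¹ E Φ`
and `D(0) = 0`. First-order perturbation of a simple eigenvalue (`exists_eigenvalue_expansion`) then
yields a multiplier `1 + c η + O(η²)` with `c = w ⬝ᵥ (A D(p) v) / w ⬝ᵥ v`, the others staying away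
from 1.

The same number appears in the period. Linearizing `u (P ε) = u 0` along a perturbed orbit
(`exists_norm_closing_le`), with `d = u 0 - φ 0`, gives `(A - 1) d + ε A D(p) v + (P ε - p) v =
o(‖d‖ + |ε| + |P ε - p|)`. Pairing with `w` kills the first term. A time shift puts the starting
point on the section `w ⬝ᵥ d = 0`, where `1 - A` is bounded below, so `d = O(ε)` and the error is
`o(ε)`. Hence `P'(0) = -c` (`IsBifurcatingFamily.hasDerivAt_period`), and continuity of the family
is enough. -/

open Set Filter Topology MeasureTheory
open scoped Matrix Matrix.Norms.Operator Kronecker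

/-! ### Dyson series for linear equations with a parameter -/

section DysonSeries

variable {𝔸 : Type*} [NormedRing 𝔸] [NormedAlgebra ℝ 𝔸]

/-- The iterated integrals of the Dyson series of the linear equation `X' = G X`, `X 0 = 1`. -/
noncomputable def dysonTerm (G : ℝ → 𝔸) : ℕ → ℝ → 𝔸
  | 0 => fun _ => 1
  | k + 1 => fun t => ∫ s in (0 : ℝ)..t, G s * dysonTerm G k s

/-- The Dyson series of `X' = η G X`, `X 0 = 1`. -/
noncomputable def dysonSeries (G : ℝ → 𝔸) (η t : ℝ) : 𝔸 :=
  1 + ∑' k : ℕ, η ^ (k + 1) • dysonTerm G (k + 1) t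

theorem continuous_dysonTerm {G : ℝ → 𝔸} (hG : Continuous G) (k : ℕ) :
    Continuous (dysonTerm G k) := by
  induction k with
  | zero => exact continuous_const
  | succ k ih =>
    exact intervalIntegral.continuous_primitive
      (fun a b => (hG.mul ih).intervalIntegrable a b) 0

theorem dysonTerm_succ_zero (G : ℝ → 𝔸) (k : ℕ) : dysonTerm G (k + 1) 0 = 0 := by
  simp [dysonTerm]

theorem dysonSeries_zero (G : ℝ → 𝔸) (η : ℝ) : dysonSeries G η 0 = 1 := by
  simp [dysonSeries, dysonTerm_succ_zero]

/-- The majorant `exp (2Mt) + exp (-2Mt)` is at least 1 and even in `t`, and integrating `M` times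
it costs only a factor 1/2. Each iterated integral therefore gains 1/2, for both signs of `t`,
without factorials. -/
theorem norm_dysonTerm_le {G : ℝ → 𝔸} {M T : ℝ} (hM : 0 < M)
    (hGM : ∀ t, |t| ≤ T → ‖G t‖ ≤ M) (k : ℕ) (t : ℝ) (ht : |t| ≤ T) :
    ‖dysonTerm G k t‖ ≤
      ‖(1 : 𝔸)‖ * (1 / 2) ^ k * (Real.exp (2 * M * t) + Real.exp (-(2 * M * t))) := by
  induction k generalizing t with
  | zero =>
    have h1 : (1 : ℝ) ≤ Real.exp (2 * M * t) + Real.exp (-(2 * M * t)) := by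
      rcases le_total 0 (2 * M * t) with h | h
      · linarith [Real.one_le_exp h, Real.exp_pos (-(2 * M * t))]
      · linarith [Real.one_le_exp (neg_nonneg.2 h), Real.exp_pos (2 * M * t)]
    simpa [dysonTerm] using le_mul_of_one_le_right (norm_nonneg (1 : 𝔸)) h1
  | succ k ih =>
    set c := ‖(1 : 𝔸)‖ * (1 / 2) ^ (k + 1) with hc
    have hc0 : 0 ≤ c := by positivity
    have hprim : ∀ s : ℝ, HasDerivAt
        (fun s => c * (Real.exp (2 * M * s) - Real.exp (-(2 * M * s))))
        (M * (‖(1 : 𝔸)‖ * (1 / 2) ^ k * (Real.exp (2 * M * s) + Real.exp (-(2 * M * s))))) s := by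
      intro s
      have h1 : HasDerivAt (fun s : ℝ => 2 * M * s) (2 * M) s := by
        simpa using (hasDerivAt_id s).const_mul (2 * M)
      refine ((h1.exp.sub h1.neg.exp).const_mul c).congr_deriv ?_
      rw [hc, pow_succ]
      simp only [Pi.neg_apply]
      ring
    have hint := intervalIntegral.integral_eq_sub_of_hasDerivAt (a := 0) (b := t)
      (fun s _ => hprim s) (Continuous.intervalIntegrable (by fun_prop) _ _)
    have hle : ‖dysonTerm G (k + 1) t‖ ≤ |∫ s in (0 : ℝ)..t,
        M * (‖(1 : 𝔸)‖ * (1 / 2) ^ k * (Real.exp (2 * M * s) + Real.exp (-(2 * M * s))))| := by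
      refine intervalIntegral.norm_integral_le_abs_of_norm_le ?_
        (Continuous.intervalIntegrable (by fun_prop) _ _)
      refine (ae_restrict_iff' measurableSet_uIoc).2 (ae_of_all _ fun s hs => ?_)
      have hsT : |s| ≤ T := by
        refine le_trans ?_ ht
        rcases mem_uIoc.1 hs with h | h
        · rw [abs_of_pos h.1, abs_of_pos (h.1.trans_le h.2)]; exact h.2
        · rw [abs_of_nonpos h.2, abs_of_neg (h.1.trans_le h.2)]; linarith [h.1]
      exact (norm_mul_le _ _).trans
        (mul_le_mul (hGM s hsT) (ih s hsT) (norm_nonneg _) hM.le)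
    rw [hint] at hle
    refine hle.trans ?_
    simp only [mul_zero, neg_zero, sub_self, sub_zero]
    rw [abs_mul, abs_of_nonneg hc0]
    gcongr
    rw [abs_le]
    constructor <;> linarith [Real.exp_pos (2 * M * t), Real.exp_pos (-(2 * M * t))]

theorem exists_norm_dysonTerm_le {G : ℝ → 𝔸} (hG : Continuous G) (T : ℝ) :
    ∃ K : ℝ, 0 ≤ K ∧ ∀ k t, |t| ≤ T → ‖dysonTerm G k t‖ ≤ K * (1 / 2) ^ k := by
  obtain ⟨M, hM⟩ := (isCompact_Icc (a := -T) (b := T)).exists_bound_of_continuousOn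
    hG.continuousOn
  have hM' : ∀ t, |t| ≤ T → ‖G t‖ ≤ max M 1 := fun t ht =>
    (hM t (abs_le.1 ht)).trans (le_max_left _ _)
  have hpos : 0 < max M 1 := lt_max_of_lt_right one_pos
  refine ⟨‖(1 : 𝔸)‖ * (2 * Real.exp (2 * max M 1 * T)), by positivity, fun k t ht => ?_⟩
  refine (norm_dysonTerm_le hpos hM' k t ht).trans ?_
  have h1 : Real.exp (2 * max M 1 * t) ≤ Real.exp (2 * max M 1 * T) := by
    gcongr; exact (le_abs_self t).trans ht
  have h2 : Real.exp (-(2 * max M 1 * t)) ≤ Real.exp (2 * max M 1 * T) := by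
    rw [← mul_neg]; gcongr; exact (neg_le_abs t).trans ht
  calc _ ≤ ‖(1 : 𝔸)‖ * (1 / 2) ^ k * (2 * Real.exp (2 * max M 1 * T)) := by
        gcongr; linarith
    _ = _ := by ring

variable [CompleteSpace 𝔸]

theorem hasDerivAt_dysonTerm {G : ℝ → 𝔸} (hG : Continuous G) (k : ℕ) (t : ℝ) :
    HasDerivAt (dysonTerm G (k + 1)) (G t * dysonTerm G k t) t :=
  intervalIntegral.integral_hasDerivAt_right
    ((hG.mul (continuous_dysonTerm hG k)).intervalIntegrable 0 t)
    ((hG.mul (continuous_dysonTerm hG k)).stronglyMeasurableAtFilter _ _)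
    (hG.mul (continuous_dysonTerm hG k)).continuousAt

theorem summable_dyson {G : ℝ → 𝔸} (hG : Continuous G) {η : ℝ} (hη : |η| ≤ 1) (t : ℝ) :
    Summable fun k : ℕ => η ^ k • dysonTerm G k t := by
  obtain ⟨K, -, hK⟩ := exists_norm_dysonTerm_le hG |t|
  refine Summable.of_norm_bounded (summable_geometric_two.mul_left K) fun k => ?_
  rw [norm_smul, norm_pow, Real.norm_eq_abs]
  calc |η| ^ k * ‖dysonTerm G k t‖ ≤ 1 * (K * (1 / 2) ^ k) :=
        mul_le_mul (pow_le_one₀ (abs_nonneg _) hη) (hK k t le_rfl) (norm_nonneg _) zero_le_one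
    _ = _ := one_mul _

theorem dysonSeries_eq_tsum {G : ℝ → 𝔸} (hG : Continuous G) {η : ℝ} (hη : |η| ≤ 1) (t : ℝ) :
    dysonSeries G η t = ∑' k : ℕ, η ^ k • dysonTerm G k t := by
  rw [(summable_dyson hG hη t).tsum_eq_zero_add]
  simp [dysonSeries, dysonTerm]

/-- The Dyson series solves the linear equation `X' = η G X`. -/
theorem hasDerivAt_dysonSeries {G : ℝ → 𝔸} (hG : Continuous G) {η : ℝ} (hη : |η| ≤ 1) (t : ℝ) :
    HasDerivAt (dysonSeries G η) (η • (G t * dysonSeries G η t)) t := by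
  set T := |t| + 1
  obtain ⟨K, hK0, hK⟩ := exists_norm_dysonTerm_le hG T
  obtain ⟨M, hM⟩ := (isCompact_Icc (a := -T) (b := T)).exists_bound_of_continuousOn
    hG.continuousOn
  have hM0 : 0 ≤ M := (norm_nonneg _).trans (hM 0 ⟨neg_nonpos.2 (by positivity), by positivity⟩)
  have hmem : ∀ y ∈ Ioo (-T) T, |y| ≤ T := fun y hy => (abs_lt.2 hy).le
  have htT : t ∈ Ioo (-T) T := abs_lt.1 (lt_add_one _)
  have key : HasDerivAt (fun y => ∑' k : ℕ, η ^ (k + 1) • dysonTerm G (k + 1) y)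
      (∑' k : ℕ, η ^ (k + 1) • (G t * dysonTerm G k t)) t := by
    refine hasDerivAt_tsum_of_isPreconnected (t := Ioo (-T) T) (y₀ := t)
      (summable_geometric_two.mul_left (M * K)) isOpen_Ioo isPreconnected_Ioo
      (fun k y _ => (hasDerivAt_dysonTerm hG k y).const_smul (η ^ (k + 1)))
      (fun k y hy => ?_) htT ?_ htT
    · rw [norm_smul, norm_pow, Real.norm_eq_abs]
      calc |η| ^ (k + 1) * ‖G y * dysonTerm G k y‖
          ≤ 1 * (M * (K * (1 / 2) ^ k)) := by
            refine mul_le_mul (pow_le_one₀ (abs_nonneg _) hη) ?_ (norm_nonneg _) zero_le_one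
            exact (norm_mul_le _ _).trans (mul_le_mul (hM y (abs_le.1 (hmem y hy)))
              (hK k y (hmem y hy)) (norm_nonneg _) hM0)
        _ = _ := by ring
    · exact (summable_nat_add_iff (f := fun k : ℕ => η ^ k • dysonTerm G k t) 1).2
        (summable_dyson hG hη t)
  refine (key.const_add 1).congr_deriv ?_
  rw [dysonSeries_eq_tsum hG hη, ← (summable_dyson hG hη t).tsum_mul_left,
    ← Summable.tsum_const_smul η ((summable_dyson hG hη t).mul_left (G t))]
  refine tsum_congr fun k => ?_
  rw [mul_smul_comm, smul_smul, pow_succ']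

/-- The tail from the second term on carries a factor `η ^ 2` and is dominated by a geometric
series, uniformly for `|η| ≤ 1`. -/
theorem exists_norm_dysonSeries_sub_le {G : ℝ → 𝔸} (hG : Continuous G) (t : ℝ) :
    ∃ C : ℝ, 0 ≤ C ∧ ∀ η : ℝ, |η| ≤ 1 →
      ‖dysonSeries G η t - 1 - η • dysonTerm G 1 t‖ ≤ C * η ^ 2 := by
  obtain ⟨K, hK0, hK⟩ := exists_norm_dysonTerm_le hG |t|
  refine ⟨K * 2, by positivity, fun η hη => ?_⟩
  have hs := summable_dyson hG hη t
  have hs1 : Summable fun k : ℕ => η ^ (k + 1) • dysonTerm G (k + 1) t :=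
    (summable_nat_add_iff (f := fun k : ℕ => η ^ k • dysonTerm G k t) 1).2 hs
  have h : dysonSeries G η t - 1 - η • dysonTerm G 1 t =
      ∑' k : ℕ, η ^ (k + 2) • dysonTerm G (k + 2) t := by
    rw [dysonSeries, hs1.tsum_eq_zero_add]
    simp
  rw [h]
  have hb : ∀ k : ℕ, ‖η ^ (k + 2) • dysonTerm G (k + 2) t‖ ≤ K * η ^ 2 * (1 / 2) ^ k := by
    intro k
    rw [norm_smul, norm_pow, Real.norm_eq_abs, pow_add, sq_abs]
    calc |η| ^ k * η ^ 2 * ‖dysonTerm G (k + 2) t‖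
        ≤ 1 * η ^ 2 * (K * (1 / 2) ^ (k + 2)) := by
          gcongr
          · exact pow_le_one₀ (abs_nonneg _) hη
          · exact hK _ t le_rfl
      _ ≤ K * η ^ 2 * (1 / 2) ^ k := by
          rw [pow_add]
          have : 0 ≤ K * η ^ 2 * (1 / 2) ^ k := by positivity
          linarith
  refine (tsum_of_norm_bounded (summable_geometric_two.mul_left (K * η ^ 2)).hasSum hb).trans ?_
  rw [tsum_mul_left, tsum_geometric_two]
  linarith

end DysonSeries

/-! ### Determinants and simple eigenvalues -/

theorem exists_smul_eq_of_finrank_le_one {K V : Type*} [Field K] [AddCommGroup V] [Module K V]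
    [FiniteDimensional K V] {S : Submodule K V} {Q : V → Prop} (v : V) (hv : v ≠ 0)
    (hmem : ∀ x, x ∈ S ↔ Q x) (hQ : Q v) (hS : Module.finrank K S ≤ 1) (x : V) (hx : Q x) :
    ∃ c : K, c • v = x := by
  obtain ⟨u, hu⟩ := finrank_le_one_iff.1 hS
  obtain ⟨a, ha⟩ := hu ⟨v, (hmem v).2 hQ⟩
  obtain ⟨b, hb⟩ := hu ⟨x, (hmem x).2 hx⟩
  have ha' : a • (u : V) = v := congrArg Subtype.val ha
  have hb' : b • (u : V) = x := congrArg Subtype.val hb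
  have ha0 : a ≠ 0 := by rintro rfl; exact hv (by rw [← ha', zero_smul])
  exact ⟨b * a⁻¹, by rw [← ha', smul_smul, inv_mul_cancel_right₀ ha0, hb']⟩

section Determinant

variable {ι 𝕜 : Type*} [Fintype ι] [DecidableEq ι] [RCLike 𝕜]

/-- The determinant as a continuous multilinear map of the rows. -/
noncomputable def detRowContinuous (ι 𝕜 : Type*) [Fintype ι] [DecidableEq ι] [RCLike 𝕜] :
    ContinuousMultilinearMap 𝕜 (fun _ : ι => ι → 𝕜) 𝕜 where
  toMultilinearMap := (Matrix.detRowAlternating (R := 𝕜) (n := ι)).toMultilinearMap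
  cont := Continuous.matrix_det (A := fun M : ι → ι → 𝕜 => Matrix.of M) continuous_id

/-- The rows of a matrix, as a continuous linear map. -/
noncomputable def matrixRows (ι 𝕜 : Type*) [Fintype ι] [DecidableEq ι] [RCLike 𝕜] :
    Matrix ι ι 𝕜 →L[𝕜] (ι → ι → 𝕜) :=
  LinearMap.toContinuousLinearMap (Matrix.ofLinearEquiv 𝕜).symm.toLinearMap

/-- The derivative of a multilinear map replaces one row at a time; Cramer's rule turns each such
determinant into a diagonal entry of `H * Y.adjugate`. -/
theorem linearDeriv_detRowContinuous (Y H : Matrix ι ι 𝕜) :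
    (detRowContinuous ι 𝕜).linearDeriv (matrixRows ι 𝕜 Y) (matrixRows ι 𝕜 H) =
      (Y.adjugate * H).trace := by
  rw [ContinuousMultilinearMap.linearDeriv_apply, Matrix.trace_mul_comm]
  refine Finset.sum_congr rfl fun i _ => ?_
  change (Y.updateRow i (H i)).det = (H * Y.adjugate) i i
  rw [← Matrix.cramer_transpose_apply, Matrix.cramer_eq_adjugate_mulVec,
    ← Matrix.adjugate_transpose, Matrix.mulVec_transpose]
  rfl

/-- Jacobi's formula. -/
theorem hasFDerivAt_det (Y : Matrix ι ι 𝕜) :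
    HasFDerivAt (fun Y : Matrix ι ι 𝕜 => Y.det)
      (((detRowContinuous ι 𝕜).linearDeriv (matrixRows ι 𝕜 Y)).comp (matrixRows ι 𝕜)) Y :=
  ((detRowContinuous ι 𝕜).hasFDerivAt (matrixRows ι 𝕜 Y)).comp Y (matrixRows ι 𝕜).hasFDerivAt

/-- The determinant is analytic, so its Taylor remainder is quadratic; uniqueness of the derivative
identifies the linear term with Jacobi's formula. -/
theorem isBigO_det_add_sub (Y : Matrix ι ι 𝕜) :
    (fun H : Matrix ι ι 𝕜 => (Y + H).det - Y.det - (Y.adjugate * H).trace) =O[𝓝 0]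
      fun H => ‖H‖ ^ 2 := by
  have han : AnalyticAt 𝕜 (fun Y : Matrix ι ι 𝕜 => Y.det) Y :=
    AnalyticAt.comp (g := detRowContinuous ι 𝕜) (f := matrixRows ι 𝕜)
      ((detRowContinuous ι 𝕜).analyticAt) ((matrixRows ι 𝕜).analyticAt Y)
  obtain ⟨q, hq⟩ := han
  have hlin : ∀ H : Matrix ι ι 𝕜, (q 1 fun _ => H) = (Y.adjugate * H).trace := by
    intro H
    rw [← linearDeriv_detRowContinuous]
    exact DFunLike.congr_fun (hq.hasFDerivAt.unique (hasFDerivAt_det Y)) H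
  have htends : Tendsto (fun H : Matrix ι ι 𝕜 => (Y + H, Y)) (𝓝 0) (𝓝 (Y, Y)) := by
    have : Continuous fun H : Matrix ι ι 𝕜 => (Y + H, Y) := by fun_prop
    simpa using this.tendsto 0
  have := hq.isBigO_image_sub_norm_mul_norm_sub.comp_tendsto htends
  refine (this.congr_left fun H => ?_).trans (Asymptotics.IsBigO.of_bound 1 (.of_forall fun H => ?_))
  · simp only [Function.comp, add_sub_cancel_left, hlin]
  · simp [Prod.norm_def, sq]

theorem hasDerivAt_det_scalar_sub (M : Matrix ι ι 𝕜) (z : 𝕜) :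
    HasDerivAt (fun z : 𝕜 => (Matrix.scalar ι z - M).det)
      ((Matrix.scalar ι z - M).adjugate.trace) z := by
  have h1 : HasDerivAt (fun z : 𝕜 => Matrix.scalar ι z - M) 1 z := by
    have : HasDerivAt (fun z : 𝕜 => z • (1 : Matrix ι ι 𝕜) - M) ((1 : 𝕜) • (1 : Matrix ι ι 𝕜)) z :=
      ((hasDerivAt_id z).smul_const _).sub_const M
    simpa only [one_smul, Matrix.smul_one_eq_diagonal, Matrix.scalar_apply] using this
  have h2 := (hasFDerivAt_det (Matrix.scalar ι z - M)).comp_hasDerivAt z h1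
  refine h2.congr_deriv ?_
  have := linearDeriv_detRowContinuous (Matrix.scalar ι z - M) 1
  rw [mul_one] at this
  exact this

theorem eval_derivative_charpoly (M : Matrix ι ι 𝕜) (z : 𝕜) :
    M.charpoly.derivative.eval z = (Matrix.scalar ι z - M).adjugate.trace := by
  have h1 := M.charpoly.hasDerivAt z
  simp only [Matrix.eval_charpoly] at h1
  exact h1.unique (hasDerivAt_det_scalar_sub M z)

theorem continuous_adjugate_trace :
    Continuous fun x : 𝕜 × Matrix ι ι 𝕜 => (Matrix.scalar ι x.1 - x.2).adjugate.trace := by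
  simp only [Matrix.scalar_apply]
  exact (((continuous_pi fun _ => continuous_fst).matrix_diagonal.sub
    continuous_snd).matrix_adjugate).matrix_trace

/-- A simple eigenvalue stays simple and isolated, locally uniformly in the matrix. -/
theorem eventually_roots_charpoly_erase {M₀ : Matrix ι ι 𝕜} {z₀ : 𝕜}
    (h₀ : (Matrix.scalar ι z₀ - M₀).adjugate.trace ≠ 0) :
    ∃ r > 0, ∀ᶠ M in 𝓝 M₀, ∀ γ, ‖γ - z₀‖ < r → M.charpoly.IsRoot γ →
      ∀ μ ∈ M.charpoly.roots.erase γ, r ≤ ‖μ - z₀‖ := by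
  set a := (Matrix.scalar ι z₀ - M₀).adjugate.trace with ha
  have hpos : 0 < ‖a‖ := norm_pos_iff.2 h₀
  have hev : ∀ᶠ x : 𝕜 × Matrix ι ι 𝕜 in 𝓝 (z₀, M₀),
      ‖(Matrix.scalar ι x.1 - x.2).adjugate.trace - a‖ < ‖a‖ / 2 := by
    have := (continuous_adjugate_trace (ι := ι) (𝕜 := 𝕜)).tendsto (z₀, M₀)
    filter_upwards [this (Metric.ball_mem_nhds _ (half_pos hpos))] with x hx
    exact mem_ball_iff_norm.1 hx
  rw [nhds_prod_eq] at hev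
  obtain ⟨pa, hpa, pb, hpb, hab⟩ := Filter.eventually_prod_iff.1 hev
  obtain ⟨r, hr, hball⟩ := Metric.eventually_nhds_iff_ball.1 hpa
  refine ⟨r, hr, hpb.mono fun M hM γ hγ hroot μ hμ => ?_⟩
  by_contra! hlt
  have hD : ∀ z ∈ Metric.ball z₀ r, ‖(Matrix.scalar ι z - M).adjugate.trace - a‖ < ‖a‖ / 2 :=
    fun z hz => hab (hball z hz) hM
  have hγb : γ ∈ Metric.ball z₀ r := by rwa [mem_ball_iff_norm]
  have hμb : μ ∈ Metric.ball z₀ r := by rwa [mem_ball_iff_norm]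
  -- With the linear part `z * a` removed, the characteristic polynomial is Lipschitz with constant
  -- `‖a‖ / 2` on the ball. Two distinct roots would make `‖a‖ ‖μ - γ‖` at most half of itself.
  have hderiv : ∀ z ∈ Metric.ball z₀ r, HasDerivWithinAt
      (fun z => (Matrix.scalar ι z - M).det - z * a)
      ((Matrix.scalar ι z - M).adjugate.trace - a) (Metric.ball z₀ r) z := fun z _ => by
    have h := (hasDerivAt_det_scalar_sub M z).sub ((hasDerivAt_id z).mul_const a)
    rw [one_mul] at h
    exact h.hasDerivWithinAt
  have hmv := (convex_ball z₀ r).norm_image_sub_le_of_norm_hasDerivWithin_le hderiv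
    (fun z hz => (hD z hz).le) hγb hμb
  have hμroot : M.charpoly.IsRoot μ := Polynomial.isRoot_of_mem_roots (Multiset.mem_of_mem_erase hμ)
  rw [Polynomial.IsRoot, Matrix.eval_charpoly] at hμroot
  have hγroot := hroot
  rw [Polynomial.IsRoot, Matrix.eval_charpoly] at hγroot
  have heq : μ = γ := by
    rw [hμroot, hγroot, show (0 - μ * a - (0 - γ * a)) = -((μ - γ) * a) by ring, norm_neg,
      norm_mul] at hmv
    by_contra hne
    have : 0 < ‖μ - γ‖ := norm_pos_iff.2 (sub_ne_zero.2 hne)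
    nlinarith
  subst heq
  -- The remaining case is a repeated root, where the derivative would vanish although it lies
  -- within `‖a‖ / 2` of `a`.
  have hcount : 1 < M.charpoly.roots.count μ := by
    have := Multiset.one_le_count_iff_mem.2 hμ
    rw [Multiset.count_erase_self] at this
    omega
  rw [Polynomial.count_roots, Polynomial.one_lt_rootMultiplicity_iff_isRoot
    M.charpoly_monic.ne_zero, Polynomial.IsRoot, Polynomial.IsRoot, eval_derivative_charpoly]
    at hcount
  have := hD μ hμb
  rw [hcount.2, zero_sub, norm_neg] at this
  linarith

/-- A simple eigenvalue: the adjugate is the product of the right and the left eigenvector. -/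
theorem exists_left_eigenvector_of_rootMultiplicity_eq_one {A : Matrix ι ι 𝕜} {z : 𝕜}
    (hA : A.charpoly.rootMultiplicity z = 1) {v : ι → 𝕜} (hv : v ≠ 0) (hAv : A *ᵥ v = z • v) :
    ∃ w : ι → 𝕜, w ⬝ᵥ v ≠ 0 ∧ w ᵥ* (Matrix.scalar ι z - A) = 0 ∧
      (Matrix.scalar ι z - A).adjugate = Matrix.vecMulVec v w ∧
      ∀ d, (Matrix.scalar ι z - A) *ᵥ d = 0 → w ⬝ᵥ d = 0 → d = 0 := by
  have hne : A.charpoly ≠ 0 := A.charpoly_monic.ne_zero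
  have hroot : A.charpoly.IsRoot z :=
    (Polynomial.rootMultiplicity_pos hne).1 (by omega)
  have htr : (Matrix.scalar ι z - A).adjugate.trace ≠ 0 := by
    rw [← eval_derivative_charpoly]
    intro h
    have := (Polynomial.one_lt_rootMultiplicity_iff_isRoot hne).2 ⟨hroot, h⟩
    omega
  have hsc : ∀ x : ι → 𝕜, Matrix.scalar ι z *ᵥ x = z • x := fun x => by
    ext i; simp [Matrix.scalar_apply, Matrix.mulVec_diagonal]
  have hspan : ∀ x : ι → 𝕜, (Matrix.scalar ι z - A) *ᵥ x = 0 → ∃ c : 𝕜, c • v = x := by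
    have hle := LinearMap.finrank_eigenspace_le (Matrix.toLin' A) z
    rw [Matrix.charpoly_toLin', hA] at hle
    have hmem : ∀ x : ι → 𝕜, x ∈ Module.End.eigenspace (Matrix.toLin' A) z ↔
        A *ᵥ x = z • x := fun x => by
      rw [Module.End.mem_eigenspace_iff, Matrix.toLin'_apply]
    intro x hx
    rw [Matrix.sub_mulVec, hsc, sub_eq_zero] at hx
    obtain ⟨c, hc⟩ := (exists_smul_eq_of_finrank_le_one v hv hmem hAv hle) x hx.symm
    exact ⟨c, hc⟩
  have hdet : (Matrix.scalar ι z - A).det = 0 := by rw [← Matrix.eval_charpoly]; exact hroot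
  -- The determinant is zero, so every column of the adjugate lies in the kernel, which is the line
  -- through `v`. The coefficients form `w`, and `w ⬝ᵥ v` is the trace of the adjugate, that is, the
  -- nonzero derivative of the characteristic polynomial.
  have hcol : ∀ j, ∃ c : 𝕜, c • v = (Matrix.scalar ι z - A).adjugate.col j := fun j => by
    refine hspan _ ?_
    ext i
    have := congrFun (congrFun ((Matrix.scalar ι z - A).mul_adjugate) i) j
    rw [hdet, zero_smul] at this
    exact this
  choose w hw using hcol
  have hN : (Matrix.scalar ι z - A).adjugate = Matrix.vecMulVec v w := by
    ext i j
    have := congrFun (hw j) i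
    simp only [Pi.smul_apply, smul_eq_mul, Matrix.col_apply] at this
    rw [← this, Matrix.vecMulVec_apply, mul_comm]
  have hwv : w ⬝ᵥ v ≠ 0 := by
    rwa [hN, Matrix.trace_vecMulVec, dotProduct_comm] at htr
  refine ⟨w, hwv, ?_, hN, fun d hd hwd => ?_⟩
  · have h := (Matrix.scalar ι z - A).adjugate_mul
    rw [hdet, zero_smul, hN, Matrix.vecMulVec_mul] at h
    obtain ⟨i, hi⟩ := Function.ne_iff.1 hv
    ext j
    have := congrFun (congrFun h i) j
    rw [Matrix.vecMulVec_apply] at this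
    exact (mul_eq_zero.1 this).resolve_left hi
  · obtain ⟨c, rfl⟩ := hspan d hd
    rw [dotProduct_smul, smul_eq_mul] at hwd
    rw [(mul_eq_zero.1 hwd).resolve_right hwv, zero_smul]

end Determinant

/-! ### Perturbation of a simple eigenvalue -/

theorem LinearMap.exists_norm_le_mul {E F : Type*} [NormedAddCommGroup E] [NormedSpace ℝ E]
    [FiniteDimensional ℝ E] [NormedAddCommGroup F] [NormedSpace ℝ F] (T : E →ₗ[ℝ] F) :
    ∃ K, 0 ≤ K ∧ ∀ x, ‖T x‖ ≤ K * ‖x‖ :=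
  ⟨‖LinearMap.toContinuousLinearMap T‖, norm_nonneg _, (LinearMap.toContinuousLinearMap T).le_opNorm⟩

section EigenvalueExpansion

variable {ι : Type*} [Fintype ι] [DecidableEq ι]

/-- A real function with a nondegenerate linear expansion in two variables has a zero branch. -/
theorem exists_zero_of_linear_expansion {h : ℝ → ℝ → ℝ} (hc : ∀ η, Continuous fun x => h x η)
    {a c K ρ : ℝ} (ha : a ≠ 0) (hρ : 0 < ρ) (hK : ∀ x η, |x| ≤ ρ → |η| ≤ ρ →
      |h x η - a * (x - c * η)| ≤ K * (x ^ 2 + η ^ 2)) :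
    ∃ η₀ > 0, ∃ C : ℝ, ∀ η, |η| < η₀ → ∃ x, h x η = 0 ∧ |x - c * η| ≤ C * η ^ 2 := by
  have hK0 : 0 ≤ K := by
    have := (abs_nonneg _).trans (hK 0 ρ (by simpa using hρ.le) (abs_of_pos hρ).le)
    have h2 : (0 : ℝ) < 0 ^ 2 + ρ ^ 2 := by positivity
    exact nonneg_of_mul_nonneg_left this h2
  set L := |c| + 1 with hL
  have hL1 : 1 ≤ L := by rw [hL]; linarith [abs_nonneg c]
  have hapos : 0 < |a| := abs_pos.2 ha
  -- Chosen so that at `x = c η ± κ η²`, where `|x| ≤ L |η|`, the error is at most `|a| κ η²`. The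
  -- function then has weakly opposite signs at the two points.
  set κ := K * (L ^ 2 + 1) / |a| with hκ
  have hκ0 : 0 ≤ κ := by positivity
  refine ⟨min (ρ / L) (1 / (κ + 1)), by positivity, κ, fun η hη => ?_⟩
  have hη1 : |η| < ρ / L := hη.trans_le (min_le_left _ _)
  have hη2 : |η| < 1 / (κ + 1) := hη.trans_le (min_le_right _ _)
  have hηρ : |η| * L ≤ ρ := ((lt_div_iff₀ (by positivity)).1 hη1).le
  have hκη : κ * η ^ 2 ≤ |η| := by
    have h1 : |η| * (κ + 1) < 1 := (lt_div_iff₀ (by positivity)).1 hη2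
    rw [← sq_abs]
    nlinarith [abs_nonneg η]
  have hmain : ∀ σ : ℝ, |σ| = 1 →
      |h (c * η + σ * (κ * η ^ 2)) η - a * (σ * (κ * η ^ 2))| ≤ |a| * (κ * η ^ 2) := by
    intro σ hσ
    set x := c * η + σ * (κ * η ^ 2) with hx
    have hxle : |x| ≤ L * |η| := by
      calc |x| ≤ |c * η| + |σ * (κ * η ^ 2)| := abs_add_le _ _
        _ = |c| * |η| + κ * η ^ 2 := by
          rw [abs_mul, abs_mul, hσ, one_mul, abs_of_nonneg (by positivity : 0 ≤ κ * η ^ 2)]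
        _ ≤ L * |η| := by rw [hL]; linarith
    have hb := hK x η (hxle.trans (by linarith)) (le_trans (by nlinarith [abs_nonneg η]) hηρ)
    rw [show x - c * η = σ * (κ * η ^ 2) by rw [hx]; ring] at hb
    refine hb.trans ?_
    have hx2 : x ^ 2 ≤ L ^ 2 * η ^ 2 := by
      rw [← sq_abs x, ← sq_abs η, ← mul_pow]
      gcongr
    calc K * (x ^ 2 + η ^ 2) ≤ K * (L ^ 2 * η ^ 2 + η ^ 2) := by gcongr
      _ = |a| * (κ * η ^ 2) := by rw [hκ]; field_simp
  have hp := abs_le.1 (hmain 1 (by simp))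
  have hm := abs_le.1 (hmain (-1) (by simp))
  simp only [one_mul, neg_mul, mul_neg, sub_neg_eq_add, ← sub_eq_add_neg] at hp hm
  have hle : c * η - κ * η ^ 2 ≤ c * η + κ * η ^ 2 := by
    have : 0 ≤ κ * η ^ 2 := by positivity
    linarith
  obtain ⟨x, hx, hx0⟩ : ∃ x ∈ Icc (c * η - κ * η ^ 2) (c * η + κ * η ^ 2), h x η = 0 := by
    rcases lt_or_gt_of_ne ha with hneg | hpos
    · rw [abs_of_neg hneg] at hp hm
      exact intermediate_value_Icc' hle (hc η).continuousOn ⟨by linarith, by linarith⟩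
    · rw [abs_of_pos hpos] at hp hm
      exact intermediate_value_Icc hle (hc η).continuousOn ⟨by linarith, by linarith⟩
  exact ⟨x, hx0, abs_le.2 ⟨by linarith [hx.1], by linarith [hx.2]⟩⟩

/-- Expansion of the determinant at a singular matrix along a two-parameter family. -/
theorem exists_abs_det_sub_le {A B₁ : Matrix ι ι ℝ} {B : ℝ → Matrix ι ι ℝ} {C : ℝ}
    (hB : ∀ η, |η| ≤ 1 → ‖B η - A - η • B₁‖ ≤ C * η ^ 2) {z : ℝ}
    (hz : (Matrix.scalar ι z - A).det = 0) :
    ∃ ρ > 0, ∃ K : ℝ, ∀ x η, |x| ≤ ρ → |η| ≤ ρ →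
      |(Matrix.scalar ι (z + x) - B η).det -
        (x * (Matrix.scalar ι z - A).adjugate.trace -
          η * ((Matrix.scalar ι z - A).adjugate * B₁).trace)| ≤ K * (x ^ 2 + η ^ 2) := by
  set Y := Matrix.scalar ι z - A with hY
  have hC : 0 ≤ C := by simpa using (norm_nonneg _).trans (hB 1 (by simp))
  obtain ⟨K, hK⟩ := (isBigO_det_add_sub Y).bound
  obtain ⟨R, hR, hball⟩ := Metric.eventually_nhds_iff_ball.1 hK
  let T : Matrix ι ι ℝ →ₗ[ℝ] ℝ :=
    (Matrix.traceLinearMap ι ℝ ℝ).comp (LinearMap.mulLeft ℝ Y.adjugate)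
  obtain ⟨K₂, hK₂, hTK⟩ := T.exists_norm_le_mul
  have hT : ∀ H, T H = (Y.adjugate * H).trace := fun H => rfl
  set S := ‖(1 : Matrix ι ι ℝ)‖ + ‖B₁‖ + C with hS
  have hS0 : 0 ≤ S := by positivity
  -- This radius keeps `‖H‖ ≤ S (|x| + |η|)` below `R`, where the quadratic bound on the determinant
  -- holds.
  refine ⟨min 1 (R / (2 * S + 1) / 2), by positivity, 2 * max K 0 * S ^ 2 + K₂ * C,
    fun x η hx hη => ?_⟩
  have hη1 : |η| ≤ 1 := hη.trans (min_le_left _ _)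
  set Q := B η - A - η • B₁ with hQ
  have hQn := hB η hη1
  have hηsq : η ^ 2 ≤ |η| := by rw [← sq_abs]; nlinarith [abs_nonneg η]
  set H : Matrix ι ι ℝ := x • 1 - η • B₁ - Q with hH
  have hHeq : Matrix.scalar ι (z + x) - B η = Y + H := by
    have : Matrix.scalar ι (z + x) = Matrix.scalar ι z + x • (1 : Matrix ι ι ℝ) := by
      rw [map_add]; simp [Matrix.scalar_apply, Matrix.smul_one_eq_diagonal]
    rw [this, hH, hQ, hY]; abel
  have hHn : ‖H‖ ≤ S * (|x| + |η|) := by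
    calc ‖H‖ ≤ ‖x • (1 : Matrix ι ι ℝ)‖ + ‖η • B₁‖ + ‖Q‖ :=
          (norm_sub_le _ _).trans (by gcongr; exact norm_sub_le _ _)
      _ ≤ |x| * ‖(1 : Matrix ι ι ℝ)‖ + |η| * ‖B₁‖ + C * |η| := by
          rw [norm_smul, norm_smul, Real.norm_eq_abs, Real.norm_eq_abs]
          gcongr
          exact hQn.trans (by gcongr)
      _ ≤ S * (|x| + |η|) := by
          rw [hS]
          nlinarith [abs_nonneg x, abs_nonneg η, norm_nonneg B₁, norm_nonneg (1 : Matrix ι ι ℝ),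
            mul_nonneg (abs_nonneg x) (norm_nonneg B₁), mul_nonneg (abs_nonneg x) hC,
            mul_nonneg (abs_nonneg η) (norm_nonneg (1 : Matrix ι ι ℝ))]
  have hHR : ‖H‖ < R := by
    have h1 : |x| + |η| ≤ R / (2 * S + 1) := by
      have := hx.trans (min_le_right _ _); have := hη.trans (min_le_right _ _); linarith
    calc ‖H‖ ≤ S * (R / (2 * S + 1)) := hHn.trans (by gcongr)
      _ = R * (S / (2 * S + 1)) := by ring
      _ < R * 1 := by
          gcongr
          rw [div_lt_one (by positivity)]; linarith
      _ = R := mul_one R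
  have hdet := hball H (by simpa using hHR)
  rw [hz, sub_zero, ← hT, Real.norm_eq_abs, norm_pow, norm_norm] at hdet
  have hTH : T H = x * Y.adjugate.trace - η * (Y.adjugate * B₁).trace - T Q := by
    rw [hH, map_sub, map_sub, map_smul, map_smul, hT 1, hT B₁, mul_one, smul_eq_mul, smul_eq_mul]
  have hsq : (|x| + |η|) ^ 2 ≤ 2 * (x ^ 2 + η ^ 2) := by
    rw [← sq_abs x, ← sq_abs η]; nlinarith [sq_nonneg (|x| - |η|)]
  rw [hHeq]
  calc |(Y + H).det - (x * Y.adjugate.trace - η * (Y.adjugate * B₁).trace)|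
      = |((Y + H).det - T H) + -T Q| := by rw [hTH]; congr 1; ring
    _ ≤ |(Y + H).det - T H| + |-T Q| := abs_add_le _ _
    _ ≤ max K 0 * ‖H‖ ^ 2 + K₂ * ‖Q‖ := by
        gcongr
        · exact hdet.trans (by gcongr; exact le_max_left _ _)
        · rw [abs_neg]; exact hTK Q
    _ ≤ max K 0 * (S * (|x| + |η|)) ^ 2 + K₂ * (C * η ^ 2) := by gcongr
    _ = max K 0 * S ^ 2 * (|x| + |η|) ^ 2 + K₂ * C * η ^ 2 := by ring
    _ ≤ max K 0 * S ^ 2 * (2 * (x ^ 2 + η ^ 2)) + K₂ * C * (x ^ 2 + η ^ 2) := by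
        gcongr
        nlinarith [sq_nonneg x]
    _ = _ := by ring

/-- First-order perturbation of a simple eigenvalue. -/
theorem exists_eigenvalue_expansion {A B₁ : Matrix ι ι ℝ} {B : ℝ → Matrix ι ι ℝ} {C : ℝ}
    (hB : ∀ η, |η| ≤ 1 → ‖B η - A - η • B₁‖ ≤ C * η ^ 2) {v w : ι → ℝ} {z : ℝ}
    (hN : (Matrix.scalar ι z - A).adjugate = Matrix.vecMulVec v w) (hwv : w ⬝ᵥ v ≠ 0)
    (hz : (Matrix.scalar ι z - A).det = 0) :
    ∃ η₀ > 0, ∃ K : ℝ, ∃ r > 0, ∀ η, |η| < η₀ → ∃ (γ : ℂ) (rest : Multiset ℂ),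
      ((B η).map (algebraMap ℝ ℂ)).charpoly.roots = γ ::ₘ rest ∧
      ‖γ - (z + (w ⬝ᵥ (B₁ *ᵥ v)) / (w ⬝ᵥ v) * η : ℝ)‖ ≤ K * η ^ 2 ∧
      ∀ μ ∈ rest, r ≤ ‖μ - z‖ := by
  set a := w ⬝ᵥ v with ha
  set c := (w ⬝ᵥ (B₁ *ᵥ v)) / a with hc
  have htr : (Matrix.scalar ι z - A).adjugate.trace = a := by
    rw [hN, Matrix.trace_vecMulVec, dotProduct_comm]
  -- Because the adjugate is the rank-one matrix `v wᵀ`, the expansion of the determinant becomes `a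
  -- (x - c η)`.
  have htr₁ : ((Matrix.scalar ι z - A).adjugate * B₁).trace = a * c := by
    rw [hN, Matrix.vecMulVec_mul, Matrix.trace_vecMulVec, dotProduct_comm,
      ← Matrix.dotProduct_mulVec, hc]
    field_simp
  obtain ⟨ρ, hρ, K₁, hK₁⟩ := exists_abs_det_sub_le hB hz
  rw [htr, htr₁] at hK₁
  have hcont : ∀ η, Continuous fun x => (Matrix.scalar ι (z + x) - B η).det := fun η => by
    simp only [Matrix.scalar_apply]
    exact ((((continuous_pi fun _ => continuous_const.add continuous_id).matrix_diagonal).sub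
      continuous_const)).matrix_det
  obtain ⟨η₁, hη₁, K, hroot⟩ := exists_zero_of_linear_expansion
    (h := fun x η => (Matrix.scalar ι (z + x) - B η).det) hcont hwv hρ
    (c := c) (K := K₁) (fun x η hx hη => by
      have := hK₁ x η hx hη
      rwa [show x * a - η * (a * c) = a * (x - c * η) by ring] at this)
  let f : Matrix ι ι ℝ → Matrix ι ι ℂ := fun M => M.map (algebraMap ℝ ℂ)
  have hf : Continuous f := continuous_id.matrix_map (Complex.continuous_ofReal)
  have hBt : Tendsto B (𝓝 0) (𝓝 A) := by
    refine tendsto_iff_norm_sub_tendsto_zero.2 ?_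
    have hlim : Tendsto (fun η : ℝ => C * η ^ 2 + |η| * ‖B₁‖) (𝓝 0) (𝓝 0) := by
      have : Continuous fun η : ℝ => C * η ^ 2 + |η| * ‖B₁‖ := by fun_prop
      simpa using this.tendsto 0
    refine squeeze_zero' (.of_forall fun _ => norm_nonneg _) ?_ hlim
    filter_upwards [Metric.closedBall_mem_nhds (0 : ℝ) one_pos] with η hη
    have hη1 : |η| ≤ 1 := by simpa using hη
    calc ‖B η - A‖ = ‖(B η - A - η • B₁) + η • B₁‖ := by rw [sub_add_cancel]
      _ ≤ ‖B η - A - η • B₁‖ + ‖η • B₁‖ := norm_add_le _ _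
      _ ≤ _ := by rw [norm_smul, Real.norm_eq_abs]; gcongr; exact hB η hη1
  have hz₀ : (Matrix.scalar ι (z : ℂ) - f A).adjugate.trace ≠ 0 := by
    have h1 : Matrix.scalar ι (z : ℂ) - f A = (algebraMap ℝ ℂ).mapMatrix (Matrix.scalar ι z - A) := by
      rw [map_sub]
      congr 1
      ext i j
      by_cases hij : i = j <;> simp [Matrix.scalar_apply, hij]
    rw [h1, ← RingHom.map_adjugate]
    have h2 : ((algebraMap ℝ ℂ).mapMatrix (Matrix.scalar ι z - A).adjugate).trace = (a : ℂ) := by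
      rw [← htr]; simp [Matrix.trace]
    rw [h2]
    exact_mod_cast hwv
  -- The branch found by the intermediate value theorem is real. Isolation is needed among complex
  -- eigenvalues, so it is taken from the complexified matrices.
  obtain ⟨r, hr, hev⟩ := eventually_roots_charpoly_erase hz₀
  have hev' : ∀ᶠ η in 𝓝 (0 : ℝ), (∀ γ : ℂ, ‖γ - z‖ < r → (f (B η)).charpoly.IsRoot γ →
      ∀ μ ∈ (f (B η)).charpoly.roots.erase γ, r ≤ ‖μ - z‖) ∧ |c * η| + K * η ^ 2 < r := by
    refine (((hf.tendsto A).comp hBt).eventually hev).and ?_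
    have : Continuous fun η : ℝ => |c * η| + K * η ^ 2 := by fun_prop
    exact this.tendsto 0 |>.eventually (gt_mem_nhds (by simpa using hr))
  obtain ⟨η₂, hη₂, hball⟩ := Metric.eventually_nhds_iff_ball.1 hev'
  refine ⟨min η₁ η₂, lt_min hη₁ hη₂, K, r, hr, fun η hη => ?_⟩
  obtain ⟨x, hx0, hx⟩ := hroot η (hη.trans_le (min_le_left _ _))
  obtain ⟨hiso, hlt⟩ := hball η (by simpa using hη.trans_le (min_le_right _ _))
  have hγ : (f (B η)).charpoly.IsRoot ((z + x : ℝ) : ℂ) := by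
    change ((B η).map (algebraMap ℝ ℂ)).charpoly.IsRoot (algebraMap ℝ ℂ (z + x))
    rw [Matrix.charpoly_map]
    exact Polynomial.IsRoot.map (by rw [Polynomial.IsRoot, Matrix.eval_charpoly]; exact hx0)
  have hγr : ‖((z + x : ℝ) : ℂ) - z‖ < r := by
    rw [← Complex.ofReal_sub, Complex.norm_real, Real.norm_eq_abs, add_sub_cancel_left]
    calc |x| = |c * η + (x - c * η)| := by congr 1; ring
      _ ≤ |c * η| + |x - c * η| := abs_add_le _ _
      _ < r := by linarith
  refine ⟨((z + x : ℝ) : ℂ), _, (Multiset.cons_erase ((Polynomial.mem_roots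
    (Matrix.charpoly_monic _).ne_zero).2 hγ)).symm, ?_, hiso _ hγr hγ⟩
  rw [← Complex.ofReal_sub, Complex.norm_real, Real.norm_eq_abs]
  calc |z + x - (z + c * η)| = |x - c * η| := by congr 1; ring
    _ ≤ _ := hx

end EigenvalueExpansion

/-! ### Fundamental matrices: inverse and dependence on the parameter -/

section MatrixODE

variable {ι : Type*}

theorem continuous_of_hasDerivAt_apply {A A' : ℝ → Matrix ι ι ℝ}
    (hA : ∀ t i k, HasDerivAt (fun s => A s i k) (A' t i k) t) : Continuous A :=
  continuous_matrix fun i k => continuous_iff_continuousAt.2 fun t => (hA t i k).continuousAt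

variable [Fintype ι]

theorem hasDerivAt_matrix_mul_apply {A B : ℝ → Matrix ι ι ℝ} {A' B' : Matrix ι ι ℝ} {t : ℝ}
    (hA : ∀ i k, HasDerivAt (fun s => A s i k) (A' i k) t)
    (hB : ∀ i k, HasDerivAt (fun s => B s i k) (B' i k) t) (i k : ι) :
    HasDerivAt (fun s => (A s * B s) i k) ((A' * B t + A t * B') i k) t := by
  simp only [Matrix.mul_apply, Matrix.add_apply, ← Finset.sum_add_distrib]
  exact HasDerivAt.fun_sum fun j _ => (hA i j).mul (hB j k)

theorem hasDerivAt_matrix_mulVec {A : ℝ → Matrix ι ι ℝ} {y : ℝ → ι → ℝ} {A' : Matrix ι ι ℝ}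
    {y' : ι → ℝ} {t : ℝ} (hA : ∀ i k, HasDerivAt (fun s => A s i k) (A' i k) t)
    (hy : HasDerivAt y y' t) :
    HasDerivAt (fun s => A s *ᵥ y s) (A' *ᵥ y t + A t *ᵥ y') t := by
  refine hasDerivAt_pi.2 fun i => ?_
  simp only [Matrix.mulVec, dotProduct, Pi.add_apply, ← Finset.sum_add_distrib]
  exact HasDerivAt.fun_sum fun j _ => (hA i j).mul (hasDerivAt_pi.1 hy j)

theorem HasDerivAt.matrix_apply {A : ℝ → Matrix ι ι ℝ} {A' : Matrix ι ι ℝ} {t : ℝ}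
    (hA : HasDerivAt A A' t) (i k : ι) : HasDerivAt (fun s => A s i k) (A' i k) t :=
  hasDerivAt_pi.1 (hasDerivAt_pi.1 hA i) k

variable [DecidableEq ι]

/-- The inverse of a principal fundamental matrix solves the adjoint equation. -/
theorem IsPrincipalFundamentalMatrix.exists_inverse {J Φ : ℝ → Matrix ι ι ℝ} (hJ : Continuous J)
    (hΦ : IsPrincipalFundamentalMatrix J Φ) :
    ∃ Z : ℝ → Matrix ι ι ℝ, (∀ t, Z t * Φ t = 1) ∧
      ∀ t i k, HasDerivAt (fun s => Z s i k) ((-(Z t * J t)) i k) t := by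
  have hG : Continuous fun t => -(J t)ᵀ := hJ.matrix_transpose.neg
  -- The transposed adjoint equation `X' = -Jᵀ X` has the form solved by a Dyson series with
  -- parameter 1; `Xᵀ Φ` then has derivative zero.
  set X := dysonSeries (fun t => -(J t)ᵀ) 1 with hX
  have hX' : ∀ t i k, HasDerivAt (fun s => X s i k) ((-(J t)ᵀ * X t) i k) t := fun t i k => by
    have := (hasDerivAt_dysonSeries hG (η := 1) (by simp) t).matrix_apply i k
    rwa [one_smul] at this
  have hZ' : ∀ t i k, HasDerivAt (fun s => (X s)ᵀ i k) ((-((X t)ᵀ * J t)) i k) t := fun t i k => by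
    have := hX' t k i
    rwa [show -((X t)ᵀ * J t) = (-(J t)ᵀ * X t)ᵀ by simp [Matrix.transpose_mul]]
  refine ⟨fun t => (X t)ᵀ, fun t => ?_, hZ'⟩
  ext i k
  have hconst : ∀ s, HasDerivAt (fun s => ((X s)ᵀ * Φ s) i k) 0 s := fun s => by
    have := hasDerivAt_matrix_mul_apply (hZ' s) (hΦ.2 s) i k
    rwa [show -((X s)ᵀ * J s) * Φ s + (X s)ᵀ * (J s * Φ s) = 0 by
      rw [Matrix.neg_mul, Matrix.mul_assoc, neg_add_cancel]] at this
  have := is_const_of_deriv_eq_zero (fun s => (hconst s).differentiableAt)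
    (fun s => (hconst s).deriv) t 0
  have hX0 : X 0 = 1 := dysonSeries_zero _ _
  rw [this, hX0, hΦ.1, Matrix.transpose_one, Matrix.mul_one]

/-- Dependence on `η` of the principal fundamental matrix of `Y' = (J(t) - η E) Y`. -/
theorem IsPrincipalFundamentalMatrix.exists_perturbation {J Φ Z : ℝ → Matrix ι ι ℝ}
    (hΦ : IsPrincipalFundamentalMatrix J Φ)
    (hZΦ : ∀ t, Z t * Φ t = 1) (hZ : Continuous Z) (E : Matrix ι ι ℝ) :
    ∃ (Ψ : ℝ → ℝ → Matrix ι ι ℝ) (D : ℝ → Matrix ι ι ℝ),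
      (∀ η, |η| ≤ 1 → IsPrincipalFundamentalMatrix (fun t => J t - η • E) (Ψ η)) ∧
      D 0 = 0 ∧ (∀ t i k, HasDerivAt (fun s => D s i k) ((-(Z t * E * Φ t)) i k) t) ∧
      ∀ p, ∃ C : ℝ, ∀ η, |η| ≤ 1 → ‖Ψ η p - Φ p - η • (Φ p * D p)‖ ≤ C * η ^ 2 := by
  have hΦc : Continuous Φ := continuous_of_hasDerivAt_apply hΦ.2
  have hG : Continuous fun t => -(Z t * E * Φ t) :=
    ((hZ.matrix_mul continuous_const).matrix_mul hΦc).neg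
  set G : ℝ → Matrix ι ι ℝ := fun t => -(Z t * E * Φ t) with hGdef
  have hΦZ : ∀ t, Φ t * Z t = 1 := fun t => mul_eq_one_comm.1 (hZΦ t)
  -- Variation of constants: `Φ X` solves the perturbed equation when `X' = η G X` with `G = -Φ⁻¹ E
  -- Φ`.
  refine ⟨fun η t => Φ t * dysonSeries G η t, dysonTerm G 1, fun η hη => ⟨?_, fun t i k => ?_⟩,
    dysonTerm_succ_zero G 0, fun t i k => ?_, fun p => ?_⟩
  · simp only [hΦ.1, dysonSeries_zero, mul_one]
  · have h := hasDerivAt_matrix_mul_apply (hΦ.2 t)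
      (fun i k => (hasDerivAt_dysonSeries hG hη t).matrix_apply i k) i k
    refine h.congr_deriv ?_
    have : Φ t * η • (G t * dysonSeries G η t) = -(η • E) * (Φ t * dysonSeries G η t) := by
      have h2 : Φ t * G t = -(E * Φ t) := by
        rw [hGdef]
        simp only [Matrix.mul_neg]
        rw [Matrix.mul_assoc (Z t), ← Matrix.mul_assoc (Φ t), hΦZ, Matrix.one_mul]
      rw [Matrix.mul_smul, ← Matrix.mul_assoc, h2]
      simp only [Matrix.neg_mul, Matrix.smul_mul, Matrix.mul_assoc, smul_neg]
    rw [this, ← Matrix.mul_assoc (-(η • E)), Matrix.mul_assoc (-(η • E)),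
      Matrix.mul_assoc (J t), ← Matrix.add_mul, ← sub_eq_add_neg]
  · have := (hasDerivAt_dysonTerm hG 0 t).matrix_apply i k
    simpa [dysonTerm, hGdef] using this
  · obtain ⟨C, -, hC⟩ := exists_norm_dysonSeries_sub_le hG p
    refine ⟨‖Φ p‖ * C, fun η hη => ?_⟩
    have : Φ p * dysonSeries G η p - Φ p - η • (Φ p * dysonTerm G 1 p) =
        Φ p * (dysonSeries G η p - 1 - η • dysonTerm G 1 p) := by
      rw [mul_sub, mul_sub, mul_one, mul_smul_comm]
    rw [this, mul_assoc]
    exact (norm_mul_le _ _).trans (by gcongr; exact hC η hη)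

end MatrixODE

/-! ### Perturbed solutions near the periodic orbit -/

/-- A `C¹` map is differentiable uniformly at the points of a compact set. -/
theorem exists_norm_sub_sub_fderiv_le {V W : Type*} [NormedAddCommGroup V]
    [NormedSpace ℝ V] [NormedAddCommGroup W] [NormedSpace ℝ W] {F : V → W} (hF : ContDiff ℝ 1 F)
    {K : Set V} (hK : IsCompact K) {θ : ℝ} (hθ : 0 < θ) :
    ∃ ρ > 0, ∀ b ∈ K, ∀ a, ‖a - b‖ ≤ ρ → ‖F a - F b - fderiv ℝ F b (a - b)‖ ≤ θ * ‖a - b‖ := by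
  refine hK.induction_on (p := fun s => ∃ ρ > 0, ∀ b ∈ s, ∀ a, ‖a - b‖ ≤ ρ →
    ‖F a - F b - fderiv ℝ F b (a - b)‖ ≤ θ * ‖a - b‖) ⟨1, one_pos, by simp⟩
    (fun s t hst ⟨ρ, hρ, h⟩ => ⟨ρ, hρ, fun b hb => h b (hst hb)⟩) ?_ ?_
  · rintro s t ⟨ρ₁, hρ₁, h₁⟩ ⟨ρ₂, hρ₂, h₂⟩
    refine ⟨min ρ₁ ρ₂, lt_min hρ₁ hρ₂, fun b hb a ha => ?_⟩
    rcases hb with hb | hb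
    · exact h₁ b hb a (ha.trans (min_le_left _ _))
    · exact h₂ b hb a (ha.trans (min_le_right _ _))
  · intro x _
    have h1 := (hF.contDiffAt.hasStrictFDerivAt (x := x) one_ne_zero).isLittleO.def (half_pos hθ)
    have h2 : ∀ᶠ b in 𝓝 x, ‖fderiv ℝ F b - fderiv ℝ F x‖ < θ / 2 := by
      have := ((hF.continuous_fderiv one_ne_zero).tendsto x) (Metric.ball_mem_nhds _ (half_pos hθ))
      filter_upwards [this] with b hb
      exact mem_ball_iff_norm.1 hb
    obtain ⟨r₁, hr₁, hb₁⟩ := Metric.eventually_nhds_iff_ball.1 h1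
    obtain ⟨r₂, hr₂, hb₂⟩ := Metric.eventually_nhds_iff_ball.1 h2
    refine ⟨Metric.ball x (min (r₁ / 2) r₂),
      mem_nhdsWithin_of_mem_nhds (Metric.ball_mem_nhds _ (by positivity)), r₁ / 4, by positivity,
      fun b hb a hab => ?_⟩
    have hbx : dist b x < r₁ / 2 := (Metric.mem_ball.1 hb).trans_le (min_le_left _ _)
    have hax : dist a x < r₁ := by
      have := dist_triangle a b x
      rw [dist_eq_norm a b] at this
      linarith
    have h3 := hb₁ (a, b) (by
      rw [Metric.mem_ball, Prod.dist_eq]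
      exact max_lt hax (hbx.trans (by linarith)))
    have h4 := hb₂ b (Metric.ball_subset_ball (min_le_right _ _) hb)
    calc ‖F a - F b - fderiv ℝ F b (a - b)‖
        = ‖(F a - F b - fderiv ℝ F x (a - b)) - (fderiv ℝ F b - fderiv ℝ F x) (a - b)‖ := by
          rw [sub_apply]; congr 1; abel
      _ ≤ θ / 2 * ‖a - b‖ + θ / 2 * ‖a - b‖ := by
          refine (norm_sub_le _ _).trans (add_le_add h3 ?_)
          exact ((fderiv ℝ F b - fderiv ℝ F x).le_opNorm _).trans (by gcongr)
      _ = θ * ‖a - b‖ := by ring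

section PerturbedOrbit

variable {m : ℕ} {E : Matrix (Fin m) (Fin m) ℝ} {F : (Fin m → ℝ) → (Fin m → ℝ)}
  {φ : ℝ → Fin m → ℝ} {p : ℝ}

/-- The relation `v = F a - ε E v` replaces inverting `1 + ε E`. Used once it bounds `v`, used again
it bounds `v - F b`, and then it gives the first-order expansion, uniformly over `K`. -/
theorem exists_norm_velocity_sub_sub_le (E : Matrix (Fin m) (Fin m) ℝ) (hF : ContDiff ℝ 1 F)
    {K : Set (Fin m → ℝ)} (hK : IsCompact K) {θ : ℝ} (hθ : 0 < θ) :
    ∃ ρ > 0, ∀ b ∈ K, ∀ (a v : Fin m → ℝ) (ε : ℝ), ‖a - b‖ ≤ ρ → |ε| ≤ ρ →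
      (1 + ε • E) *ᵥ v = F a →
      ‖v - F b - (fderiv ℝ F b (a - b) - ε • E *ᵥ F b)‖ ≤ θ * (‖a - b‖ + |ε|) := by
  obtain ⟨C₀, hC₀⟩ := hK.exists_bound_of_continuousOn hF.continuous.continuousOn
  obtain ⟨C₁, hC₁⟩ := hK.exists_bound_of_continuousOn
    (hF.continuous_fderiv one_ne_zero).continuousOn
  obtain ⟨ρ₁, hρ₁, h₁⟩ := exists_norm_sub_sub_fderiv_le hF hK one_pos
  obtain ⟨ρ₂, hρ₂, h₂⟩ := exists_norm_sub_sub_fderiv_le hF hK (half_pos hθ)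
  set L := |C₁| + 1 with hL
  set V := 2 * (|C₀| + L * ρ₁) with hV
  set S := ‖E‖ * (L + ‖E‖ * V + 1) with hS
  have hL0 : 0 ≤ L := by positivity
  have hV0 : 0 ≤ V := by positivity
  have hS0 : 0 ≤ S := by positivity
  -- The third bound makes `|ε| ‖E‖ ≤ 1/2`, so that `ε E v` is absorbed into `v`; the fourth makes
  -- the mixed and quadratic terms at most `θ / 2`.
  refine ⟨min (min ρ₁ ρ₂) (min (1 / (2 * (‖E‖ + 1))) (θ / (2 * (S + 1)))), by positivity,
    fun b hb a v ε ha hε hv => ?_⟩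
  have ha₁ := ha.trans ((min_le_left _ _).trans (min_le_left _ _))
  have ha₂ := ha.trans ((min_le_left _ _).trans (min_le_right _ _))
  have hε₁ : |ε| * ‖E‖ ≤ 1 / 2 := by
    have := (le_div_iff₀ (by positivity)).1 (hε.trans ((min_le_right _ _).trans (min_le_left _ _)))
    nlinarith [abs_nonneg ε]
  have hε₂ : |ε| * S ≤ θ / 2 := by
    have := (le_div_iff₀ (by positivity)).1 (hε.trans ((min_le_right _ _).trans (min_le_right _ _)))
    nlinarith [abs_nonneg ε]
  have hv' : v = F a - ε • E *ᵥ v := by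
    rw [← hv, Matrix.add_mulVec, Matrix.one_mulVec, Matrix.smul_mulVec, add_sub_cancel_right]
  have hEn : ∀ x : Fin m → ℝ, ‖ε • E *ᵥ x‖ ≤ |ε| * ‖E‖ * ‖x‖ := fun x => by
    rw [norm_smul, Real.norm_eq_abs, mul_assoc]
    gcongr
    exact Matrix.linfty_opNorm_mulVec E x
  have hFab : ‖F a - F b‖ ≤ L * ‖a - b‖ := by
    have h3 : ‖fderiv ℝ F b (a - b)‖ ≤ |C₁| * ‖a - b‖ :=
      ((fderiv ℝ F b).le_opNorm _).trans (by gcongr; exact (hC₁ b hb).trans (le_abs_self _))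
    calc ‖F a - F b‖ = ‖(F a - F b - fderiv ℝ F b (a - b)) + fderiv ℝ F b (a - b)‖ := by
          rw [sub_add_cancel]
      _ ≤ 1 * ‖a - b‖ + |C₁| * ‖a - b‖ := (norm_add_le _ _).trans (add_le_add (h₁ b hb a ha₁) h3)
      _ = L * ‖a - b‖ := by rw [hL]; ring
  have hFa : ‖F a‖ ≤ |C₀| + L * ρ₁ := by
    calc ‖F a‖ = ‖F b + (F a - F b)‖ := by rw [add_sub_cancel]
      _ ≤ |C₀| + L * ρ₁ := (norm_add_le _ _).trans (add_le_add
          ((hC₀ b hb).trans (le_abs_self _)) (hFab.trans (by gcongr)))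
  have hvn : ‖v‖ ≤ V := by
    have h4 : ‖v‖ ≤ ‖F a‖ + ‖ε • E *ᵥ v‖ := by
      conv_lhs => rw [hv']
      exact norm_sub_le _ _
    have h5 := hEn v
    have h6 : |ε| * ‖E‖ * ‖v‖ ≤ 1 / 2 * ‖v‖ := by gcongr
    rw [hV]; linarith
  have hvF : ‖v - F b‖ ≤ L * ‖a - b‖ + |ε| * ‖E‖ * V := by
    calc ‖v - F b‖ = ‖(F a - F b) - ε • E *ᵥ v‖ := by conv_lhs => rw [hv', sub_right_comm]
      _ ≤ _ := (norm_sub_le _ _).trans (add_le_add hFab ((hEn v).trans (by gcongr)))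
  calc ‖v - F b - (fderiv ℝ F b (a - b) - ε • E *ᵥ F b)‖
      = ‖(F a - F b - fderiv ℝ F b (a - b)) - ε • E *ᵥ (v - F b)‖ := by
        conv_lhs => rw [hv']
        rw [Matrix.mulVec_sub, smul_sub]; congr 1; abel
    _ ≤ θ / 2 * ‖a - b‖ + |ε| * ‖E‖ * (L * ‖a - b‖ + |ε| * ‖E‖ * V) :=
        (norm_sub_le _ _).trans (add_le_add (h₂ b hb a ha₂) ((hEn _).trans (by gcongr)))
    _ = θ / 2 * ‖a - b‖ + |ε| * (‖E‖ * L) * ‖a - b‖ + |ε| * (‖E‖ * (‖E‖ * V)) * |ε| := by ring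
    _ ≤ θ / 2 * ‖a - b‖ + |ε| * S * ‖a - b‖ + |ε| * S * |ε| := by
        have hE0 := norm_nonneg E
        have : 0 ≤ ‖E‖ * V := by positivity
        gcongr
        · rw [hS]; gcongr; linarith
        · rw [hS]; gcongr; linarith
    _ ≤ θ / 2 * ‖a - b‖ + θ / 2 * ‖a - b‖ + θ / 2 * |ε| := by gcongr
    _ ≤ θ * (‖a - b‖ + |ε|) := by nlinarith [abs_nonneg ε]

/-- Solutions of the perturbed systems that start near `φ 0` stay near `φ`. -/
theorem exists_norm_perturbedSolution_sub_le (E : Matrix (Fin m) (Fin m) ℝ) (hF : ContDiff ℝ 1 F)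
    (hφ : ∀ t, HasDerivAt φ (F (φ t)) t) {T : ℝ} (hT : 0 ≤ T) :
    ∃ L ≥ 1, ∃ ρ > 0, ∀ ε u, IsPerturbedSolution E F ε u → ‖u 0 - φ 0‖ + |ε| ≤ ρ →
      ∀ t ∈ Icc 0 T, ‖u t - φ t‖ ≤ L * (‖u 0 - φ 0‖ + |ε|) := by
  have hφc : Continuous φ := continuous_iff_continuousAt.2 fun t => (hφ t).continuousAt
  have hK : IsCompact (φ '' Icc 0 T) := isCompact_Icc.image hφc
  obtain ⟨C₀, hC₀⟩ := hK.exists_bound_of_continuousOn hF.continuous.continuousOn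
  obtain ⟨C₁, hC₁⟩ := hK.exists_bound_of_continuousOn
    (hF.continuous_fderiv one_ne_zero).continuousOn
  obtain ⟨ρ, hρ, h⟩ := exists_norm_velocity_sub_sub_le E hF hK one_pos
  set M := |C₁| + ‖E‖ * |C₀| + 1 with hM
  have hM0 : 0 < M := by positivity
  set L := Real.exp ((2 * M + 1) * T) with hL
  have hL1 : 1 ≤ L := Real.one_le_exp (by positivity)
  refine ⟨L, hL1, ρ / (L + 1) / 2, by positivity, fun ε u hu hsmall t ht => ?_⟩
  have hvel : ∀ s ∈ Icc 0 T, ‖u s - φ s‖ ≤ ρ → |ε| ≤ ρ → ∀ v, (1 + ε • E) *ᵥ v = F (u s) →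
      ‖v - F (φ s)‖ ≤ M * (‖u s - φ s‖ + |ε|) := by
    intro s hs hus hε v hv
    have hb : φ s ∈ φ '' Icc 0 T := mem_image_of_mem φ hs
    have h1 := h (φ s) hb (u s) v ε hus hε hv
    have h2 : ‖fderiv ℝ F (φ s) (u s - φ s)‖ ≤ |C₁| * ‖u s - φ s‖ :=
      ((fderiv ℝ F (φ s)).le_opNorm _).trans
        (by gcongr; exact (hC₁ _ hb).trans (le_abs_self _))
    have h3 : ‖ε • E *ᵥ F (φ s)‖ ≤ |ε| * (‖E‖ * |C₀|) := by
      rw [norm_smul, Real.norm_eq_abs]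
      gcongr
      exact (Matrix.linfty_opNorm_mulVec E _).trans
        (by gcongr; exact (hC₀ _ hb).trans (le_abs_self _))
    calc ‖v - F (φ s)‖ = ‖(v - F (φ s) - (fderiv ℝ F (φ s) (u s - φ s) - ε • E *ᵥ F (φ s))) +
          (fderiv ℝ F (φ s) (u s - φ s) - ε • E *ᵥ F (φ s))‖ := by rw [sub_add_cancel]
      _ ≤ 1 * (‖u s - φ s‖ + |ε|) + (|C₁| * ‖u s - φ s‖ + |ε| * (‖E‖ * |C₀|)) :=
        (norm_add_le _ _).trans (add_le_add h1 ((norm_sub_le _ _).trans (add_le_add h2 h3)))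
      _ ≤ M * (‖u s - φ s‖ + |ε|) := by
        rw [hM]
        have := mul_nonneg (abs_nonneg C₁) (abs_nonneg ε)
        have := mul_nonneg (mul_nonneg (norm_nonneg E) (abs_nonneg C₀)) (norm_nonneg (u s - φ s))
        linarith
  choose v hv hvF using hu
  -- Barrier argument: if the deviation reaches `B = σ exp ((2M + 1) s)`, its speed is at most `M (B
  -- + |ε|) ≤ 2 M B`, strictly below `B' = (2M + 1) B`. The strict inequality needs `σ > 0`, so `σ`
  -- is lowered to `‖u 0 - φ 0‖ + |ε|` only afterwards.
  have key : ∀ σ, 0 < σ → ‖u 0 - φ 0‖ + |ε| ≤ σ → σ ≤ ρ / (L + 1) → ‖u t - φ t‖ ≤ L * σ := by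
    intro σ hσ hle hσρ
    have hLσ : L * σ ≤ ρ := by
      have := (le_div_iff₀ (by positivity)).1 hσρ
      nlinarith
    have hεσ : |ε| ≤ σ := by linarith [norm_nonneg (u 0 - φ 0)]
    have hBT : ∀ s ∈ Icc 0 T, σ * Real.exp ((2 * M + 1) * s) ≤ L * σ := fun s hs => by
      rw [mul_comm, hL]; gcongr; exact hs.2
    have hB : ∀ s : ℝ, HasDerivAt (fun s => σ * Real.exp ((2 * M + 1) * s))
        ((2 * M + 1) * (σ * Real.exp ((2 * M + 1) * s))) s := fun s => by
      have h1 : HasDerivAt (fun s : ℝ => (2 * M + 1) * s) (2 * M + 1) s := by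
        simpa using (hasDerivAt_id s).const_mul (2 * M + 1)
      exact (h1.exp.const_mul σ).congr_deriv (by ring)
    refine le_trans (image_norm_le_of_norm_deriv_right_lt_deriv_boundary
      (f := fun s => u s - φ s) (f' := fun s => v s - F (φ s))
      (fun s _ => ((hv s).sub (hφ s)).continuousAt.continuousWithinAt)
      (fun s _ => ((hv s).sub (hφ s)).hasDerivWithinAt) ?_ hB (fun s hs heq => ?_) ht) (hBT t ht)
    · simpa using (le_add_of_nonneg_right (abs_nonneg ε)).trans hle
    · have hsT : s ∈ Icc 0 T := Ico_subset_Icc_self hs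
      have hB1 : σ ≤ σ * Real.exp ((2 * M + 1) * s) :=
        le_mul_of_one_le_right hσ.le (Real.one_le_exp (mul_nonneg (by positivity) hs.1))
      have h1 := hvel s hsT (heq.trans_le ((hBT s hsT).trans hLσ))
        (hεσ.trans (by nlinarith)) (v s) (hvF s)
      refine h1.trans_lt ?_
      rw [heq]
      nlinarith
  refine le_of_forall_pos_le_add fun e he => ?_
  have h2 := key (‖u 0 - φ 0‖ + |ε| + min (e / L) (ρ / (L + 1) / 2)) (by positivity)
    (le_add_of_nonneg_right (by positivity)) (by
      have := min_le_right (e / L) (ρ / (L + 1) / 2); linarith)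
  refine h2.trans ?_
  rw [mul_add]
  gcongr
  calc L * min (e / L) (ρ / (L + 1) / 2) ≤ L * (e / L) := by gcongr; exact min_le_left _ _
    _ = e := by field_simp

end PerturbedOrbit

/-! ### The linearized closing condition -/

theorem jacobian_mulVec {ι : Type*} [Fintype ι] [DecidableEq ι] (G : (ι → ℝ) → (ι → ℝ))
    (x y : ι → ℝ) : jacobian G x *ᵥ y = fderiv ℝ G x y := by
  rw [jacobian, LinearMap.toMatrix'_mulVec]; rfl

theorem continuous_jacobian {ι : Type*} [Fintype ι] [DecidableEq ι] {G : (ι → ℝ) → (ι → ℝ)}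
    (hG : ContDiff ℝ 1 G) : Continuous (jacobian G) := by
  refine continuous_matrix fun i k => ?_
  simp only [jacobian, LinearMap.toMatrix'_apply, ContinuousLinearMap.coe_coe]
  exact (continuous_apply i).comp ((hG.continuous_fderiv one_ne_zero).clm_apply continuous_const)

theorem IsPerturbedSolution.comp_add_const {m : ℕ} {E : Matrix (Fin m) (Fin m) ℝ}
    {F : (Fin m → ℝ) → (Fin m → ℝ)} {ε : ℝ} {u : ℝ → Fin m → ℝ}
    (hu : IsPerturbedSolution E F ε u) (s : ℝ) : IsPerturbedSolution E F ε fun t => u (t + s) := by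
  intro t
  obtain ⟨v, hv, hvF⟩ := hu (t + s)
  exact ⟨v, hv.comp_add_const t s, hvF⟩

section ClosedOrbit

variable {m : ℕ} {E : Matrix (Fin m) (Fin m) ℝ} {F : (Fin m → ℝ) → (Fin m → ℝ)}
  {φ : ℝ → Fin m → ℝ} {p : ℝ}

/-- Linearization of the closing condition `u S = u 0` for perturbed solutions near `φ`. -/
theorem exists_norm_closing_le (hF : ContDiff ℝ 1 F) (hφ : ∀ t, HasDerivAt φ (F (φ t)) t)
    (hp : 0 < p) (hper : φ p = φ 0) {Z : ℝ → Matrix (Fin m) (Fin m) ℝ}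
    {A : Matrix (Fin m) (Fin m) ℝ} (hZ0 : Z 0 = 1) (hAZ : A * Z p = 1)
    (hZ : ∀ t i k, HasDerivAt (fun s => Z s i k) ((-(Z t * jacobian F (φ t))) i k) t)
    {z₁ : ℝ → Fin m → ℝ} (hz₁0 : z₁ 0 = 0)
    (hz₁ : ∀ t, HasDerivAt z₁ (-(Z t *ᵥ (E *ᵥ F (φ t)))) t) {θ : ℝ} (hθ : 0 < θ) :
    ∃ ρ > 0, ∀ ε u S, IsPerturbedSolution E F ε u → |ε| ≤ ρ → ‖u 0 - φ 0‖ ≤ ρ → |S - p| ≤ ρ →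
      u S = u 0 →
      ‖A *ᵥ (u 0 - φ 0) - (u 0 - φ 0) + ε • A *ᵥ z₁ p + (S - p) • F (φ 0)‖ ≤
        θ * (‖u 0 - φ 0‖ + |ε| + |S - p|) := by
  have hφc : Continuous φ := continuous_iff_continuousAt.2 fun t => (hφ t).continuousAt
  have hZc : Continuous Z := continuous_of_hasDerivAt_apply hZ
  -- Since `ρ ≤ 1` and `ρ ≤ p`, all times within `ρ` of `p` lie in `[0, T]`.
  set T := p + 1 with hT
  have hK : IsCompact (φ '' Icc 0 T) := isCompact_Icc.image hφc
  obtain ⟨L, hL1, ρ₁, hρ₁, hdev⟩ := exists_norm_perturbedSolution_sub_le E hF hφ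
    (T := T) (by positivity)
  obtain ⟨CZ, hCZ⟩ := (isCompact_Icc (a := 0) (b := T)).exists_bound_of_continuousOn
    hZc.continuousOn
  obtain ⟨C₀, hC₀⟩ := hK.exists_bound_of_continuousOn hF.continuous.continuousOn
  obtain ⟨C₁, hC₁⟩ := hK.exists_bound_of_continuousOn
    (hF.continuous_fderiv one_ne_zero).continuousOn
  set M := |C₁| + ‖E‖ * |C₀| + 1 with hM
  have hM0 : 0 < M := by positivity
  set Q := ‖A‖ * (|CZ| * (L + 1) * p) + 1 with hQ
  have hL0 : 0 ≤ L := zero_le_one.trans hL1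
  have hQ0 : 0 < Q := by positivity
  -- The accuracy `θ / Q` compensates for transport over one period; the cap 1 is a crude bound used
  -- for the motion between `p` and `S`.
  obtain ⟨ρ₂, hρ₂, hvel⟩ := exists_norm_velocity_sub_sub_le E hF hK
    (lt_min one_pos (div_pos hθ hQ0))
  have hFφ : ∀ᶠ t in 𝓝 p, ‖F (φ t) - F (φ p)‖ < θ / 2 := by
    filter_upwards [((hF.continuous.comp hφc).tendsto p)
      (Metric.ball_mem_nhds _ (half_pos hθ))] with t ht
    exact mem_ball_iff_norm.1 ht
  obtain ⟨ρ₃, hρ₃, hFball⟩ := Metric.eventually_nhds_iff_ball.1 hFφ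
  set ρ := min (min (ρ₁ / 2) (min (ρ₂ / (L + 1) / 2) (θ / (4 * M * (L + 1)))))
    (min (ρ₃ / 2) (min p 1)) with hρ
  have hρ0 : 0 < ρ := by positivity
  have hρa : ρ ≤ ρ₁ / 2 := (min_le_left _ _).trans (min_le_left _ _)
  have hρb : ρ ≤ ρ₂ / (L + 1) / 2 :=
    (min_le_left _ _).trans ((min_le_right _ _).trans (min_le_left _ _))
  have hρc : ρ ≤ θ / (4 * M * (L + 1)) :=
    (min_le_left _ _).trans ((min_le_right _ _).trans (min_le_right _ _))
  have hρd : ρ ≤ ρ₃ / 2 := (min_le_right _ _).trans (min_le_left _ _)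
  have hρe : ρ ≤ p := (min_le_right _ _).trans ((min_le_right _ _).trans (min_le_left _ _))
  have hρf : ρ ≤ 1 := (min_le_right _ _).trans ((min_le_right _ _).trans (min_le_right _ _))
  refine ⟨ρ, hρ0, fun ε u S hu hε hd hS hclose => ?_⟩
  set d := u 0 - φ 0 with hddef
  set σ := ‖d‖ + |ε| with hσ
  have hσ0 : 0 ≤ σ := by positivity
  have hσρ : σ ≤ 2 * ρ := by rw [hσ]; linarith
  have hy := hdev ε u hu (show σ ≤ ρ₁ by linarith)
  have hεσ : |ε| ≤ σ := by rw [hσ]; linarith [norm_nonneg d]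
  have hLσ : (L + 1) * σ ≤ ρ₂ := by
    have : (L + 1) * σ ≤ (L + 1) * (ρ₂ / (L + 1)) := by gcongr; linarith
    rwa [mul_div_cancel₀ _ (by positivity)] at this
  choose v hv hvF using hu
  have hrem : ∀ t ∈ Icc 0 T, ‖v t - F (φ t) - (fderiv ℝ F (φ t) (u t - φ t) - ε • E *ᵥ F (φ t))‖ ≤
      min 1 (θ / Q) * ((L + 1) * σ) := by
    intro t ht
    refine (hvel (φ t) (mem_image_of_mem φ ht) (u t) (v t) ε ?_ ?_ (hvF t)).trans ?_
    · exact (hy t ht).trans (by nlinarith)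
    · nlinarith
    · gcongr
      have := hy t ht
      linarith
  -- the deviation from the linear flow over one period
  have hz : ‖Z p *ᵥ (u p - φ p) - d - ε • z₁ p‖ ≤
      |CZ| * (θ / Q * ((L + 1) * σ)) * p := by
    -- `Z' = -Z J` cancels the linear term and `z₁` cancels the forcing, so only the transported
    -- remainder is left to integrate.
    have hder : ∀ t, HasDerivAt (fun t => Z t *ᵥ (u t - φ t) - ε • z₁ t)
        (Z t *ᵥ (v t - F (φ t) - (fderiv ℝ F (φ t) (u t - φ t) - ε • E *ᵥ F (φ t)))) t := by
      intro t
      refine ((hasDerivAt_matrix_mulVec (hZ t) ((hv t).sub (hφ t))).sub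
        ((hz₁ t).const_smul ε)).congr_deriv ?_
      rw [← jacobian_mulVec, Matrix.neg_mulVec, ← Matrix.mulVec_mulVec]
      simp only [Pi.sub_apply, Matrix.mulVec_sub, Matrix.mulVec_smul, smul_neg]
      abel
    have hb : ∀ t ∈ Ico 0 p, ‖Z t *ᵥ (v t - F (φ t) -
        (fderiv ℝ F (φ t) (u t - φ t) - ε • E *ᵥ F (φ t)))‖ ≤
        |CZ| * (θ / Q * ((L + 1) * σ)) := by
      intro t ht
      have htT : t ∈ Icc 0 T := ⟨ht.1, by linarith [ht.2]⟩
      refine (Matrix.linfty_opNorm_mulVec _ _).trans ?_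
      have h1 := (hrem t htT).trans (show _ ≤ θ / Q * ((L + 1) * σ) by
        gcongr; exact min_le_right _ _)
      gcongr
      exact (hCZ t htT).trans (le_abs_self _)
    have := norm_image_sub_le_of_norm_deriv_le_segment'
      (fun t _ => (hder t).hasDerivWithinAt) hb p (right_mem_Icc.2 hp.le)
    simp only [hz₁0, hZ0, Matrix.one_mulVec, smul_zero, sub_zero] at this
    rwa [sub_right_comm] at this
  have hyp : ‖(u p - φ p) - A *ᵥ d - ε • A *ᵥ z₁ p‖ ≤ θ * σ := by
    have h1 : ∀ x y z : Fin m → ℝ, x - A *ᵥ y - ε • A *ᵥ z =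
        A *ᵥ (Z p *ᵥ x - y - ε • z) := fun x y z => by
      rw [Matrix.mulVec_sub, Matrix.mulVec_sub, Matrix.mulVec_mulVec, hAZ, Matrix.one_mulVec,
        Matrix.mulVec_smul]
    rw [h1]
    calc _ ≤ ‖A‖ * (|CZ| * (θ / Q * ((L + 1) * σ)) * p) :=
          (Matrix.linfty_opNorm_mulVec _ _).trans (by gcongr)
      _ = (Q - 1) / Q * (θ * σ) := by rw [hQ]; ring
      _ ≤ 1 * (θ * σ) := by
          gcongr
          rw [div_le_one hQ0]; linarith
      _ = θ * σ := one_mul _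
  -- the motion between the times `p` and `S`
  have hSp : ‖(u S - u p) - (S - p) • F (φ 0)‖ ≤ θ * |S - p| := by
    have hder : ∀ t ∈ Metric.closedBall p ρ, HasDerivWithinAt (fun t => u t - t • F (φ 0))
        (v t - (1 : ℝ) • F (φ 0)) (Metric.closedBall p ρ) t := fun t _ =>
      ((hv t).sub ((hasDerivAt_id t).smul_const (F (φ 0)))).hasDerivWithinAt
    have hb : ∀ t ∈ Metric.closedBall p ρ, ‖v t - (1 : ℝ) • F (φ 0)‖ ≤ θ := by
      intro t ht
      have hta : |t - p| ≤ ρ := by rwa [Metric.mem_closedBall, Real.dist_eq] at ht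
      have htb := abs_le.1 hta
      have htT : t ∈ Icc 0 T := ⟨by linarith, by linarith⟩
      have h1 := hFball t (by rw [Metric.mem_ball, Real.dist_eq]; linarith)
      have hb' : φ t ∈ φ '' Icc 0 T := mem_image_of_mem φ htT
      have h2 : ‖fderiv ℝ F (φ t) (u t - φ t)‖ ≤ |C₁| * (L * σ) :=
        ((fderiv ℝ F (φ t)).le_opNorm _).trans (mul_le_mul
          ((hC₁ _ hb').trans (le_abs_self _)) (hy t htT) (norm_nonneg _) (abs_nonneg _))
      have h3 : ‖ε • E *ᵥ F (φ t)‖ ≤ σ * (‖E‖ * |C₀|) := by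
        rw [norm_smul, Real.norm_eq_abs]
        gcongr
        exact (Matrix.linfty_opNorm_mulVec E _).trans
          (by gcongr; exact (hC₀ _ hb').trans (le_abs_self _))
      have h4 := (hrem t htT).trans (show _ ≤ 1 * ((L + 1) * σ) by
        gcongr; exact min_le_left _ _)
      have h5 : ‖v t - F (φ t)‖ ≤ M * (L + 1) * σ := by
        calc ‖v t - F (φ t)‖
            = ‖(v t - F (φ t) - (fderiv ℝ F (φ t) (u t - φ t) - ε • E *ᵥ F (φ t))) +
              (fderiv ℝ F (φ t) (u t - φ t) - ε • E *ᵥ F (φ t))‖ := by rw [sub_add_cancel]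
          _ ≤ 1 * ((L + 1) * σ) + (|C₁| * (L * σ) + σ * (‖E‖ * |C₀|)) :=
            (norm_add_le _ _).trans (add_le_add h4 ((norm_sub_le _ _).trans (add_le_add h2 h3)))
          _ ≤ M * (L + 1) * σ := by
            rw [hM]
            have := mul_nonneg (abs_nonneg C₁) hσ0
            have := mul_nonneg (mul_nonneg (mul_nonneg (norm_nonneg E) (abs_nonneg C₀)) hL0) hσ0
            linarith
      have h6 : M * (L + 1) * σ ≤ θ / 2 := by
        have := (le_div_iff₀ (by positivity)).1 hρc
        have h7 : M * (L + 1) * σ ≤ M * (L + 1) * (2 * ρ) := by gcongr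
        linarith
      rw [one_smul, ← hper]
      calc ‖v t - F (φ p)‖ = ‖(v t - F (φ t)) + (F (φ t) - F (φ p))‖ := by rw [sub_add_sub_cancel]
        _ ≤ θ := (norm_add_le _ _).trans (by linarith)
    have := (convex_closedBall p ρ).norm_image_sub_le_of_norm_hasDerivWithin_le hder hb
      (Metric.mem_closedBall_self hρ0.le) (show S ∈ Metric.closedBall p ρ by
        rwa [Metric.mem_closedBall, Real.dist_eq])
    rw [Real.norm_eq_abs] at this
    refine le_of_eq_of_le ?_ this
    rw [sub_smul]; congr 1; abel
  calc ‖A *ᵥ d - d + ε • A *ᵥ z₁ p + (S - p) • F (φ 0)‖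
      = ‖-((u p - φ p) - A *ᵥ d - ε • A *ᵥ z₁ p) - ((u S - u p) - (S - p) • F (φ 0))‖ := by
        rw [hclose, hper, hddef]; congr 1; abel
    _ ≤ θ * σ + θ * |S - p| := (norm_sub_le _ _).trans (by rw [norm_neg]; exact add_le_add hyp hSp)
    _ = θ * (σ + |S - p|) := by ring

end ClosedOrbit

/-! ### Derivative of the period function -/

section PeriodDerivative

variable {m : ℕ} {E : Matrix (Fin m) (Fin m) ℝ} {F : (Fin m → ℝ) → (Fin m → ℝ)}
  {φ : ℝ → Fin m → ℝ} {p : ℝ} {ε₀ : ℝ} {ψ : ℝ → ℝ → Fin m → ℝ} {P : ℝ → ℝ}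

/-- The orbits of a bifurcating family cross the section `w ⬝ᵥ (x - φ 0) = 0` near `φ 0`. -/
theorem IsBifurcatingFamily.eventually_exists_section (hF : ContDiff ℝ 1 F)
    (hφ : ∀ t, HasDerivAt φ (F (φ t)) t) (hp : 0 < p) (hper : φ p = φ 0)
    (hψ : IsBifurcatingFamily E F φ ε₀ ψ P) {w : Fin m → ℝ} (hw : w ⬝ᵥ F (φ 0) ≠ 0)
    {ρ : ℝ} (hρ : 0 < ρ) :
    ∀ᶠ ε in 𝓝 0, ∃ s, ‖ψ ε s - φ 0‖ ≤ ρ ∧ w ⬝ᵥ (ψ ε s - φ 0) = 0 := by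
  have hφc : Continuous φ := continuous_iff_continuousAt.2 fun t => (hφ t).continuousAt
  set a := w ⬝ᵥ F (φ 0) with ha
  have hdotc : Continuous fun x : Fin m → ℝ => w ⬝ᵥ x :=
    continuous_const.dotProduct continuous_id
  -- The crossing is sought near time `p` rather than 0, because the deviation estimate covers
  -- forward times only.
  have hq : HasDerivAt (fun t => w ⬝ᵥ (φ t - φ 0)) a p := by
    have h1 := (hφ p).sub_const (φ 0)
    rw [hper] at h1
    simp only [dotProduct, ha]
    exact HasDerivAt.fun_sum fun i _ => (hasDerivAt_pi.1 h1 i).const_mul (w i)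
  have hlin := hq.isLittleO.def (half_pos (abs_pos.2 hw))
  have hnear : ∀ᶠ t in 𝓝 p, ‖φ t - φ 0‖ < ρ / 2 := by
    filter_upwards [(hφc.tendsto p) (Metric.ball_mem_nhds _ (half_pos hρ))] with t ht
    rw [← hper]
    exact mem_ball_iff_norm.1 ht
  obtain ⟨κ₀, hκ₀, hball⟩ := Metric.eventually_nhds_iff_ball.1 (hlin.and hnear)
  set κ := min (κ₀ / 2) (min p 1) with hκ
  have hκ0 : 0 < κ := by positivity
  have hκa : κ < κ₀ := (min_le_left _ _).trans_lt (half_lt_self hκ₀)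
  have hκp : κ ≤ p := (min_le_right _ _).trans (min_le_left _ _)
  have hκ1 : κ ≤ 1 := (min_le_right _ _).trans (min_le_right _ _)
  have hsign : ∀ σ : ℝ, |σ| = 1 →
      |w ⬝ᵥ (φ (p + σ * κ) - φ 0) - σ * κ * a| ≤ |a| / 2 * κ := by
    intro σ hσ
    have := (hball (p + σ * κ) (by
      rw [Metric.mem_ball, Real.dist_eq, add_sub_cancel_left, abs_mul, hσ, abs_of_pos hκ0]
      linarith)).1
    rw [add_sub_cancel_left, hper, sub_self, dotProduct_zero, sub_zero, smul_eq_mul,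
      Real.norm_eq_abs, Real.norm_eq_abs, abs_mul σ κ, hσ, one_mul, abs_of_pos hκ0] at this
    exact this
  have ha2 : 0 < a * a := mul_self_pos.2 hw
  have hsgn : ∀ x y : ℝ, |x - y| ≤ |a| / 2 * κ → -(a * a / 2 * κ) ≤ a * x - a * y ∧
      a * x - a * y ≤ a * a / 2 * κ := by
    intro x y hxy
    rw [← abs_le, ← mul_sub, abs_mul]
    calc |a| * |x - y| ≤ |a| * (|a| / 2 * κ) := by gcongr
      _ = |a| * |a| / 2 * κ := by ring
      _ = a * a / 2 * κ := by rw [abs_mul_abs_self]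
  have hplus : 0 < a * (w ⬝ᵥ (φ (p + κ) - φ 0)) := by
    have := hsgn _ _ (hsign 1 (by simp))
    simp only [one_mul] at this
    nlinarith [mul_pos ha2 hκ0]
  -- The factor `a` makes the sign change independent of the sign of `a`. Convergence at the two
  -- times `p ± κ` then carries it over to `ψ ε`.
  have hminus : a * (w ⬝ᵥ (φ (p - κ) - φ 0)) < 0 := by
    have := hsgn _ _ (hsign (-1) (by simp))
    simp only [neg_mul, one_mul, ← sub_eq_add_neg] at this
    nlinarith [mul_pos ha2 hκ0]
  obtain ⟨L, hL1, ρ₁, hρ₁, hdev⟩ := exists_norm_perturbedSolution_sub_le E hF hφ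
    (T := p + 1) (by positivity)
  have hL0 : 0 < L := by linarith
  have hpt : ∀ t, Tendsto (fun ε => ψ ε t) (𝓝 0) (𝓝 (φ t)) := fun t => by
    have := (hψ.continuousAt t).tendsto
    rwa [hψ.at_zero] at this
  have hval : ∀ t, Tendsto (fun ε => a * (w ⬝ᵥ (ψ ε t - φ 0))) (𝓝 0)
      (𝓝 (a * (w ⬝ᵥ (φ t - φ 0)))) := fun t =>
    ((hdotc.tendsto _).comp ((hpt t).sub_const (φ 0))).const_mul a
  have hinit : Tendsto (fun ε => ‖ψ ε 0 - φ 0‖ + |ε|) (𝓝 0) (𝓝 0) := by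
    have h1 := ((hpt 0).sub_const (φ 0)).norm
    have h2 : Tendsto (fun ε : ℝ => |ε|) (𝓝 0) (𝓝 |(0 : ℝ)|) := continuous_abs.tendsto 0
    simpa using h1.add h2
  filter_upwards [(hval (p + κ)).eventually (lt_mem_nhds hplus),
    (hval (p - κ)).eventually (gt_mem_nhds hminus),
    hinit.eventually (gt_mem_nhds (show 0 < min ρ₁ (ρ / (2 * L)) by positivity)),
    Metric.ball_mem_nhds (0 : ℝ) hψ.pos] with ε h1 h2 h3 h4
  have hε : |ε| < ε₀ := by simpa using h4
  have hsol := hψ.solution ε hε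
  choose v hv _ using hsol
  have hc : Continuous (ψ ε) := continuous_iff_continuousAt.2 fun t => (hv t).continuousAt
  obtain ⟨s, hs, hs0⟩ := intermediate_value_Icc (by linarith : p - κ ≤ p + κ)
    (f := fun t => a * (w ⬝ᵥ (ψ ε t - φ 0)))
    (continuous_const.mul (hdotc.comp (hc.sub continuous_const))).continuousOn
    (show (0 : ℝ) ∈ Icc _ _ from ⟨h2.le, h1.le⟩)
  refine ⟨s, ?_, (mul_eq_zero.1 hs0).resolve_left hw⟩
  have h5 := hdev ε (ψ ε) (hψ.solution ε hε) (h3.le.trans (min_le_left _ _)) s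
    ⟨by linarith [hs.1], by linarith [hs.2]⟩
  have h6 : L * (‖ψ ε 0 - φ 0‖ + |ε|) ≤ ρ / 2 := by
    calc _ ≤ L * (ρ / (2 * L)) := by gcongr; exact h3.le.trans (min_le_right _ _)
      _ = ρ / 2 := by field_simp
  have h7 := (hball s (by
    rw [Metric.mem_ball, Real.dist_eq]
    exact (abs_le.2 ⟨by linarith [hs.1], by linarith [hs.2]⟩).trans_lt hκa)).2
  calc ‖ψ ε s - φ 0‖ = ‖(ψ ε s - φ s) + (φ s - φ 0)‖ := by rw [sub_add_sub_cancel]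
    _ ≤ ρ := (norm_add_le _ _).trans (by linarith)

/-- A linear map that is injective on the kernel of a functional is bounded below there. -/
theorem exists_norm_le_of_dotProduct_eq_zero {B : Matrix (Fin m) (Fin m) ℝ} {w : Fin m → ℝ}
    (hinj : ∀ d, B *ᵥ d = 0 → w ⬝ᵥ d = 0 → d = 0) :
    ∃ K, 0 ≤ K ∧ ∀ d, w ⬝ᵥ d = 0 → ‖d‖ ≤ K * ‖B *ᵥ d‖ := by
  let T : (Fin m → ℝ) →ₗ[ℝ] (Fin m → ℝ) × ℝ :=
    B.mulVecLin.prod (dotProductBilin ℝ ℝ w)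
  have hT : ∀ d, T d = (B *ᵥ d, w ⬝ᵥ d) := fun d => rfl
  have hker : LinearMap.ker T = ⊥ := by
    refine LinearMap.ker_eq_bot'.2 fun d hd => ?_
    rw [hT, Prod.mk_eq_zero] at hd
    exact hinj d hd.1 hd.2
  obtain ⟨K, -, hK⟩ := T.exists_antilipschitzWith hker
  refine ⟨K, K.2, fun d hd => ?_⟩
  have := hK.le_mul_dist d 0
  rw [dist_zero_right, map_zero, dist_zero_right, hT, hd] at this
  simpa [Prod.norm_def] using this

/-- The period function of a bifurcating family is differentiable. -/
theorem IsBifurcatingFamily.hasDerivAt_period (hF : ContDiff ℝ 1 F)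
    (hφ : ∀ t, HasDerivAt φ (F (φ t)) t) (hp : IsMinPeriod φ p)
    (hψ : IsBifurcatingFamily E F φ ε₀ ψ P) {A : Matrix (Fin m) (Fin m) ℝ} {g w : Fin m → ℝ}
    (hw : w ⬝ᵥ F (φ 0) ≠ 0) (hwA : w ᵥ* (1 - A) = 0)
    (hinj : ∀ d, (1 - A) *ᵥ d = 0 → w ⬝ᵥ d = 0 → d = 0)
    (hclose : ∀ θ > 0, ∃ ρ > 0, ∀ ε u S, IsPerturbedSolution E F ε u → |ε| ≤ ρ →
      ‖u 0 - φ 0‖ ≤ ρ → |S - p| ≤ ρ → u S = u 0 →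
      ‖A *ᵥ (u 0 - φ 0) - (u 0 - φ 0) + ε • g + (S - p) • F (φ 0)‖ ≤
        θ * (‖u 0 - φ 0‖ + |ε| + |S - p|)) :
    HasDerivAt P (-((w ⬝ᵥ g) / (w ⬝ᵥ F (φ 0)))) 0 := by
  have hper : φ p = φ 0 := by simpa using hp.1.2 0
  have hP0 : P 0 = p := by
    have h1 := hψ.minPeriod 0 (by simpa using hψ.pos)
    rw [hψ.at_zero] at h1
    exact IsLeast.unique h1 hp
  set v := F (φ 0) with hv
  set a := w ⬝ᵥ v with ha
  have hapos : 0 < |a| := abs_pos.2 hw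
  obtain ⟨K, hK0, hK⟩ := exists_norm_le_of_dotProduct_eq_zero hinj
  obtain ⟨W, hW0, hW⟩ := (dotProductBilin ℝ ℝ w).exists_norm_le_mul
  set α := |a|⁻¹ with hα
  set G := |w ⬝ᵥ g| with hG
  -- The constants come from the inequality `N ≤ θ C₁ N + C₂ |ε|` below; `θ C₁ ≤ 1/2` allows `N` to
  -- be absorbed, giving `N = O(ε)`.
  set C₁ := α * W + K + K * ‖v‖ * (α * W) with hC₁
  set C₂ := 1 + α * G + K * ‖g‖ + K * ‖v‖ * (α * G) with hC₂
  have hα0 : 0 < α := inv_pos.2 hapos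
  have hG0 : 0 ≤ G := abs_nonneg _
  have hC₁0 : 0 ≤ C₁ := by positivity
  have hC₂0 : 0 ≤ C₂ := by positivity
  rw [hasDerivAt_iff_isLittleO, Asymptotics.isLittleO_iff]
  intro c hc
  set θ := min (1 / (2 * (C₁ + 1))) (c / (2 * (α * W * C₂ + 1))) with hθ
  have hθ0 : 0 < θ := by positivity
  have hθ1 : θ * C₁ ≤ 1 / 2 := by
    have := (le_div_iff₀ (by positivity)).1 (min_le_left _ _ : θ ≤ 1 / (2 * (C₁ + 1)))
    linarith
  have hθ2 : θ * (2 * (α * W * C₂)) ≤ c := by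
    have := (le_div_iff₀ (by positivity)).1
      (min_le_right _ _ : θ ≤ c / (2 * (α * W * C₂ + 1)))
    linarith
  obtain ⟨ρ, hρ, hcl⟩ := hclose θ hθ0
  have hPt : Tendsto P (𝓝 0) (𝓝 p) := by
    have := hψ.continuousAt_period.tendsto
    rwa [hP0] at this
  filter_upwards [hψ.eventually_exists_section hF hφ hp.1.1 hper hw hρ,
    Metric.ball_mem_nhds (0 : ℝ) hψ.pos, Metric.closedBall_mem_nhds (0 : ℝ) hρ,
    hPt (Metric.closedBall_mem_nhds p hρ)] with ε hs h1 h2 h3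
  obtain ⟨s, hsρ, hsw⟩ := hs
  have hε₀ : |ε| < ε₀ := by simpa using h1
  have hερ : |ε| ≤ ρ := by simpa using h2
  have hPρ : |P ε - p| ≤ ρ := h3
  -- The phase of `ψ ε` is arbitrary; the shifted orbit starts on the section and has the same
  -- period.
  have hQ := hcl ε (fun t => ψ ε (t + s)) (P ε) ((hψ.solution ε hε₀).comp_add_const s) hερ
    (by simpa using hsρ) hPρ (by
      rw [zero_add, add_comm]; exact (hψ.minPeriod ε hε₀).1.2 s)
  simp only [zero_add] at hQ
  set d := ψ ε s - φ 0 with hd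
  set τ := P ε - p with hτ
  clear_value d τ
  set N := ‖d‖ + |ε| + |τ| with hN
  have hN0 : 0 ≤ N := by positivity
  set q := A *ᵥ d - d + ε • g + τ • v with hq
  -- The left eigenvector removes the unknown displacement, leaving a scalar equation for `τ`.
  have hwd : w ⬝ᵥ (A *ᵥ d - d) = 0 := by
    have : w ⬝ᵥ ((1 - A) *ᵥ d) = 0 := by rw [Matrix.dotProduct_mulVec, hwA, zero_dotProduct]
    rw [Matrix.sub_mulVec, Matrix.one_mulVec] at this
    rw [← neg_sub, dotProduct_neg, this, neg_zero]
  have hwq : w ⬝ᵥ q = ε * (w ⬝ᵥ g) + τ * a := by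
    rw [hq, dotProduct_add, dotProduct_add, hwd, zero_add, dotProduct_smul, dotProduct_smul,
      smul_eq_mul, smul_eq_mul]
  have hwqn : |w ⬝ᵥ q| ≤ W * (θ * N) := (hW q).trans (by gcongr)
  have hmain : |τ + ε * ((w ⬝ᵥ g) / a)| ≤ α * W * θ * N := by
    have : τ + ε * ((w ⬝ᵥ g) / a) = (w ⬝ᵥ q) / a := by rw [hwq]; field_simp; ring
    rw [this, abs_div, div_eq_inv_mul]
    calc _ ≤ α * (W * (θ * N)) := by gcongr
      _ = _ := by ring
  have hτn : |τ| ≤ α * W * θ * N + α * G * |ε| := by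
    calc |τ| = |(τ + ε * ((w ⬝ᵥ g) / a)) - ε * ((w ⬝ᵥ g) / a)| := by rw [add_sub_cancel_right]
      _ ≤ |τ + ε * ((w ⬝ᵥ g) / a)| + |ε * ((w ⬝ᵥ g) / a)| := abs_sub _ _
      _ ≤ α * W * θ * N + α * G * |ε| := by
        gcongr
        rw [abs_mul, abs_div, div_eq_inv_mul, mul_comm]
  have hdn : ‖d‖ ≤ K * (θ * N + |ε| * ‖g‖ + |τ| * ‖v‖) := by
    refine (hK d hsw).trans ?_
    gcongr
    have : (1 - A) *ᵥ d = ε • g + τ • v - q := by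
      rw [hq, Matrix.sub_mulVec, Matrix.one_mulVec]; abel
    rw [this]
    calc _ ≤ ‖ε • g‖ + ‖τ • v‖ + ‖q‖ :=
          (norm_sub_le _ _).trans (by gcongr; exact norm_add_le _ _)
      _ ≤ |ε| * ‖g‖ + |τ| * ‖v‖ + θ * N := by
          rw [norm_smul, norm_smul, Real.norm_eq_abs, Real.norm_eq_abs]; gcongr
      _ = _ := by ring
  have hNle : N ≤ 2 * C₂ * |ε| := by
    have h4 : ‖d‖ ≤ K * (θ * N + |ε| * ‖g‖ + (α * W * θ * N + α * G * |ε|) * ‖v‖) :=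
      hdn.trans (by gcongr)
    have h5 : N ≤ θ * C₁ * N + C₂ * |ε| := by
      rw [hC₁, hC₂]
      calc N = ‖d‖ + |ε| + |τ| := hN
        _ ≤ K * (θ * N + |ε| * ‖g‖ + (α * W * θ * N + α * G * |ε|) * ‖v‖) + |ε| +
            (α * W * θ * N + α * G * |ε|) := by gcongr
        _ = _ := by ring
    have h6 : θ * C₁ * N ≤ 1 / 2 * N := by gcongr
    linarith
  rw [hP0, sub_zero, ← hτ, smul_eq_mul, mul_neg, sub_neg_eq_add, Real.norm_eq_abs,
    Real.norm_eq_abs]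
  calc |τ + ε * ((w ⬝ᵥ g) / a)| ≤ α * W * θ * (2 * C₂ * |ε|) := hmain.trans (by gcongr)
    _ = θ * (2 * (α * W * C₂)) * |ε| := by ring
    _ ≤ c * |ε| := by gcongr

end PeriodDerivative

/-! ### Splitting into the synchronous part and its complement -/

section Synchronization

/-- The average over the patches. -/
noncomputable def averageMatrix (n : ℕ) : Matrix (Fin n) (Fin n) ℝ := Matrix.of fun _ _ => (n : ℝ)⁻¹

theorem averageMatrix_mul_self (n : ℕ) : averageMatrix n * averageMatrix n = averageMatrix n := by
  ext i j
  rcases eq_or_ne n 0 with rfl | hn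
  · exact i.elim0
  · simp [averageMatrix, Matrix.mul_apply, hn]

theorem trace_averageMatrix {n : ℕ} (hn : n ≠ 0) : (averageMatrix n).trace = 1 := by
  simp [averageMatrix, Matrix.trace, hn]

theorem isHermitian_averageMatrix (n : ℕ) : (averageMatrix n).IsHermitian := by
  ext i j; simp [averageMatrix]

theorem Matrix.charpoly_blockDiagonal {R o ι : Type*} [CommRing R] [Fintype o] [DecidableEq o]
    [Fintype ι] [DecidableEq ι] (M : o → Matrix ι ι R) :
    (Matrix.blockDiagonal M).charpoly = ∏ k, (M k).charpoly := by
  simp only [Matrix.charpoly]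
  rw [← Matrix.det_blockDiagonal]
  congr 1
  ext ⟨i, k⟩ ⟨j, l⟩
  by_cases h : k = l
  · subst h
    simp [Matrix.charmatrix_apply, Matrix.blockDiagonal_apply, Matrix.diagonal_apply]
  · simp [Matrix.blockDiagonal_apply, h]

theorem charpoly_diagonal_kronecker_add {R o ι : Type*} [CommRing R] [Fintype o] [DecidableEq o]
    [Fintype ι] [DecidableEq ι] (a b : o → R) (A B : Matrix ι ι R) :
    (Matrix.diagonal a ⊗ₖ A + Matrix.diagonal b ⊗ₖ B).charpoly =
      ∏ k, (a k • A + b k • B).charpoly := by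
  rw [← Matrix.charpoly_blockDiagonal, ← Matrix.charpoly_reindex (Equiv.prodComm o ι)]
  congr 1
  ext ⟨i, k⟩ ⟨j, l⟩
  by_cases h : k = l
  · subst h; simp [Matrix.blockDiagonal_apply]
  · simp [Matrix.blockDiagonal_apply, h]

/-- For a symmetric projection `Q` of rank one, `Q ⊗ A + (1 - Q) ⊗ B` is similar to the block
diagonal matrix with one block `A` and all other blocks `B`. -/
theorem charpoly_kronecker_projection {ι : Type*} [Fintype ι] [DecidableEq ι] {n : ℕ}
    {Q : Matrix (Fin n) (Fin n) ℝ} (hQ : Q.IsHermitian) (hQQ : Q * Q = Q) (hQt : Q.trace = 1)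
    (A B : Matrix ι ι ℝ) :
    (Q ⊗ₖ A + (1 - Q) ⊗ₖ B).charpoly = A.charpoly * B.charpoly ^ (n - 1) := by
  set U : Matrix (Fin n) (Fin n) ℝ := hQ.eigenvectorUnitary.1
  set e := hQ.eigenvalues
  have hUU : star U * U = 1 := Matrix.UnitaryGroup.star_mul_self _
  have hUU' : U * star U = 1 := mul_eq_one_comm.1 hUU
  have hspec : Q = U * Matrix.diagonal e * star U := by
    have := hQ.spectral_theorem
    rwa [Unitary.conjStarAlgAut_apply] at this
  have hdiag : Matrix.diagonal e = star U * Q * U := by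
    rw [hspec]
    simp only [Matrix.mul_assoc]
    rw [hUU, Matrix.mul_one, ← Matrix.mul_assoc, hUU, Matrix.one_mul]
  have hidem : ∀ i, e i = 0 ∨ e i = 1 := by
    have h1 : Matrix.diagonal e * Matrix.diagonal e = Matrix.diagonal e := by
      rw [hdiag]
      calc star U * Q * U * (star U * Q * U) = star U * (Q * (U * star U) * Q) * U := by
            simp only [Matrix.mul_assoc]
        _ = star U * Q * U := by rw [hUU', Matrix.mul_one, hQQ]
    intro i
    rw [Matrix.diagonal_mul_diagonal] at h1
    have h2 : e i * e i = e i := congrFun (Matrix.diagonal_injective h1) i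
    rcases eq_or_ne (e i) 0 with h | h
    · exact Or.inl h
    · exact Or.inr (mul_left_cancel₀ h (by rw [h2, mul_one]))
  have hsum : ∑ i, e i = 1 := by
    rw [← hQt, hQ.trace_eq_sum_eigenvalues]; rfl
  have hconj : Q ⊗ₖ A + (1 - Q) ⊗ₖ B = (U ⊗ₖ (1 : Matrix ι ι ℝ)) *
      (Matrix.diagonal e ⊗ₖ A + Matrix.diagonal (1 - e) ⊗ₖ B) *
      (star U ⊗ₖ (1 : Matrix ι ι ℝ)) := by
    have h1 : 1 - Q = U * Matrix.diagonal (1 - e) * star U := by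
      have : Matrix.diagonal (1 - e) = 1 - Matrix.diagonal e := by
        rw [← Matrix.diagonal_one, Matrix.diagonal_sub]; rfl
      rw [this, Matrix.mul_sub, Matrix.sub_mul, ← hspec, Matrix.mul_one, hUU']
    rw [Matrix.mul_add, Matrix.add_mul, ← Matrix.mul_kronecker_mul, ← Matrix.mul_kronecker_mul,
      ← Matrix.mul_kronecker_mul, ← Matrix.mul_kronecker_mul, Matrix.one_mul, Matrix.one_mul,
      Matrix.mul_one, Matrix.mul_one, ← hspec, ← h1]
  rw [hconj, Matrix.charpoly_mul_comm, ← Matrix.mul_assoc, ← Matrix.mul_kronecker_mul, hUU,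
    Matrix.one_mul, Matrix.one_kronecker_one, Matrix.one_mul, charpoly_diagonal_kronecker_add]
  have hprod : ∀ i, (e i • A + (1 - e) i • B).charpoly = if e i = 1 then A.charpoly else B.charpoly := by
    intro i
    rcases hidem i with h | h <;> simp [h]
  simp only [hprod]
  rw [Finset.prod_ite, Finset.prod_const, Finset.prod_const]
  -- The eigenvalues are 0 or 1 and sum to the trace 1.
  have hcard : (Finset.univ.filter fun i => e i = 1).card = 1 := by
    have : ∑ i, e i = ∑ i, if e i = 1 then (1 : ℝ) else 0 :=
      Finset.sum_congr rfl fun i _ => by rcases hidem i with h | h <;> simp [h]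
    rw [hsum, Finset.sum_boole] at this
    exact_mod_cast this.symm
  have hcard' := Finset.card_filter_add_card_filter_not (s := Finset.univ) fun i => e i = 1
  rw [hcard, Finset.card_univ, Fintype.card_fin] at hcard'
  rw [hcard, pow_one, Nat.eq_sub_of_add_eq' hcard']

variable {m : ℕ}

/-- Diffusion does not act on synchronous states, and all modes of zero patch average feel the same
matrix `n E`; hence a single kinetic-size system describes all of them. -/
theorem couplingMatrix_eq_kronecker {n : ℕ} (hn : n ≠ 0) (E : Matrix (Fin m) (Fin m) ℝ) :
    couplingMatrix n E = (1 - averageMatrix n) ⊗ₖ ((n : ℝ) • E) := by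
  have hn' : (n : ℝ) ≠ 0 := Nat.cast_ne_zero.2 hn
  ext ⟨j, k⟩ ⟨i, l⟩
  by_cases h : j = i
  · simp [couplingMatrix, averageMatrix, h]; field_simp
  · simp [couplingMatrix, averageMatrix, h]; field_simp

/-- The principal fundamental matrix of the linearized patch model. -/
theorem isPrincipalFundamentalMatrix_patchLinearization {n : ℕ} (hn : n ≠ 0)
    {E : Matrix (Fin m) (Fin m) ℝ} {F : (Fin m → ℝ) → (Fin m → ℝ)} (hF : Differentiable ℝ F)
    {φ : ℝ → Fin m → ℝ} {δ : ℝ} {Φ Ψ : ℝ → Matrix (Fin m) (Fin m) ℝ}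
    (hΦ : IsPrincipalFundamentalMatrix (fun t => jacobian F (φ t)) Φ)
    (hΨ : IsPrincipalFundamentalMatrix (fun t => jacobian F (φ t) - ((n : ℝ) * δ) • E) Ψ) :
    IsPrincipalFundamentalMatrix (patchLinearization n E F φ δ)
      fun t => averageMatrix n ⊗ₖ Φ t + (1 - averageMatrix n) ⊗ₖ Ψ t := by
  refine ⟨?_, fun t p q => ?_⟩
  · beta_reduce
    rw [hΦ.1, hΨ.1, ← Matrix.add_kronecker, add_sub_cancel, Matrix.one_kronecker_one]
  · set Q := averageMatrix n with hQdef
    set J := jacobian F (φ t) with hJ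
    have hJ' : (Matrix.of fun p q : Fin n × Fin m => if p.1 = q.1 then J p.2 q.2 else 0) =
        (1 : Matrix (Fin n) (Fin n) ℝ) ⊗ₖ J := by
      ext ⟨j, k⟩ ⟨i, l⟩
      by_cases h : j = i <;> simp [h]
    have hQQ : Q * Q = Q := averageMatrix_mul_self n
    have hQR : Q * (1 - Q) = 0 := by rw [Matrix.mul_sub, hQQ, Matrix.mul_one, sub_self]
    have hRQ : (1 - Q) * Q = 0 := by rw [Matrix.sub_mul, hQQ, Matrix.one_mul, sub_self]
    have hRR : (1 - Q) * (1 - Q) = 1 - Q := by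
      rw [Matrix.mul_sub, Matrix.mul_one, hRQ, sub_zero]
    -- The cross term vanishes because `(1 - Q) * Q = 0`: the coupling meets only `Ψ`.
    have hmul : patchLinearization n E F φ δ t * (Q ⊗ₖ Φ t + (1 - Q) ⊗ₖ Ψ t) =
        Q ⊗ₖ (J * Φ t) + (1 - Q) ⊗ₖ ((J - ((n : ℝ) * δ) • E) * Ψ t) := by
      rw [patchLinearization_eq n E F hF, hJ', couplingMatrix_eq_kronecker hn, ← hQdef,
        Matrix.add_mul, Matrix.mul_add, Matrix.mul_add, Matrix.smul_mul, Matrix.smul_mul,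
        ← Matrix.mul_kronecker_mul, ← Matrix.mul_kronecker_mul, ← Matrix.mul_kronecker_mul,
        ← Matrix.mul_kronecker_mul, hRQ, hRR, Matrix.one_mul, Matrix.one_mul,
        Matrix.zero_kronecker, smul_zero, zero_add, Matrix.sub_mul]
      have : (-δ) • (1 - Q) ⊗ₖ ((n : ℝ) • E * Ψ t) = (1 - Q) ⊗ₖ (-(((n : ℝ) * δ) • E * Ψ t)) := by
        rw [← Matrix.kronecker_smul]
        congr 1
        rw [Matrix.smul_mul, Matrix.smul_mul, smul_smul, ← neg_smul]
        congr 1; ring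
      rw [this, sub_eq_add_neg (J * Ψ t), Matrix.kronecker_add]
      abel
    rw [hmul]
    simp only [Matrix.add_apply, Matrix.kroneckerMap_apply]
    exact ((hΦ.2 t p.2 q.2).const_mul _).add ((hΨ.2 t p.2 q.2).const_mul _)

theorem hasFloquetMultipliers_patchLinearization {n : ℕ} (hn : n ≠ 0)
    {E : Matrix (Fin m) (Fin m) ℝ} {F : (Fin m → ℝ) → (Fin m → ℝ)} (hF : Differentiable ℝ F)
    {φ : ℝ → Fin m → ℝ} {δ p : ℝ} {Φ Ψ : ℝ → Matrix (Fin m) (Fin m) ℝ}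
    (hΦ : IsPrincipalFundamentalMatrix (fun t => jacobian F (φ t)) Φ)
    (hΨ : IsPrincipalFundamentalMatrix (fun t => jacobian F (φ t) - ((n : ℝ) * δ) • E) Ψ) :
    HasFloquetMultipliers (patchLinearization n E F φ δ) p
      (((Φ p).map (algebraMap ℝ ℂ)).charpoly.roots +
        (n - 1) • ((Ψ p).map (algebraMap ℝ ℂ)).charpoly.roots) := by
  refine ⟨_, isPrincipalFundamentalMatrix_patchLinearization hn hF hΦ hΨ, ?_⟩
  rw [Matrix.charpoly_map, charpoly_kronecker_projection (isHermitian_averageMatrix n)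
    (averageMatrix_mul_self n) (trace_averageMatrix hn), Polynomial.map_mul, Polynomial.map_pow,
    ← Matrix.charpoly_map, ← Matrix.charpoly_map, Polynomial.roots_mul, Polynomial.roots_pow]
  exact ((Matrix.charpoly_monic _).mul ((Matrix.charpoly_monic _).pow _)).ne_zero

end Synchronization

/-! ### Velocity of the orbit and assembly of the multipliers -/

theorem Multiset.exists_pos_le_norm_sub_one {M : Multiset ℂ} (hM : ∀ μ ∈ M, ‖μ‖ < 1) :
    ∃ r > 0, ∀ μ ∈ M, r ≤ ‖μ - 1‖ := by
  induction M using Multiset.induction_on with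
  | empty => exact ⟨1, one_pos, by simp⟩
  | cons a s ih =>
    obtain ⟨r, hr, h⟩ := ih fun μ hμ => hM μ (Multiset.mem_cons_of_mem hμ)
    have ha : a ≠ 1 := by
      rintro rfl
      simpa using hM 1 (Multiset.mem_cons_self _ _)
    refine ⟨min r ‖a - 1‖, lt_min hr (norm_pos_iff.2 (sub_ne_zero.2 ha)), fun μ hμ => ?_⟩
    rcases Multiset.mem_cons.1 hμ with rfl | hμ
    · exact min_le_right _ _
    · exact (min_le_left _ _).trans (h μ hμ)

theorem Fin.univ_val_map_ite {α : Type*} {n : ℕ} (hn : n ≠ 0) (a b : α) :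
    (Finset.univ : Finset (Fin n)).val.map (fun j : Fin n => if (j : ℕ) = 0 then a else b) =
      a ::ₘ (n - 1) • ({b} : Multiset α) := by
  obtain ⟨k, rfl⟩ := Nat.exists_eq_succ_of_ne_zero hn
  rw [Fin.univ_val_map, List.ofFn_succ, Multiset.nsmul_singleton]
  simp [List.ofFn_const, ← Multiset.cons_coe, Multiset.coe_replicate]

/-- A nonconstant solution has nonzero velocity. -/
theorem velocity_ne_zero_of_isMinPeriod {m : ℕ} {F : (Fin m → ℝ) → (Fin m → ℝ)}
    {φ : ℝ → Fin m → ℝ} (hφ : ∀ t, HasDerivAt φ (F (φ t)) t) {p : ℝ} (hp : IsMinPeriod φ p)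
    {Φ : ℝ → Matrix (Fin m) (Fin m) ℝ} (hΦ : ∀ t, F (φ t) = Φ t *ᵥ F (φ 0)) : F (φ 0) ≠ 0 := by
  intro h0
  have hconst : ∀ s t, φ s = φ t := is_const_of_deriv_eq_zero
    (fun t => (hφ t).differentiableAt) fun t => by rw [(hφ t).deriv, hΦ, h0, Matrix.mulVec_zero]
  have := hp.2 (show p / 2 ∈ _ from ⟨half_pos hp.1.1, fun t => hconst _ _⟩)
  linarith [hp.1.1]

/-- The velocity solves the variational equation. -/
theorem velocity_eq_mulVec {m : ℕ} {F : (Fin m → ℝ) → (Fin m → ℝ)} (hF : Differentiable ℝ F)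
    {φ : ℝ → Fin m → ℝ} (hφ : ∀ t, HasDerivAt φ (F (φ t)) t)
    {Φ Z : ℝ → Matrix (Fin m) (Fin m) ℝ} (hZ0 : Z 0 = 1) (hΦZ : ∀ t, Φ t * Z t = 1)
    (hZ : ∀ t i k, HasDerivAt (fun s => Z s i k) ((-(Z t * jacobian F (φ t))) i k) t) (t : ℝ) :
    F (φ t) = Φ t *ᵥ F (φ 0) := by
  -- Pulling the velocity back by `Z = Φ⁻¹` gives a constant, which avoids a uniqueness theorem for
  -- the variational equation.
  have hder : ∀ s, HasDerivAt (fun s => Z s *ᵥ F (φ s)) 0 s := fun s => by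
    have h1 : HasDerivAt (fun s => F (φ s)) (jacobian F (φ s) *ᵥ F (φ s)) s := by
      rw [jacobian_mulVec]
      exact (hF (φ s)).hasFDerivAt.comp_hasDerivAt s (hφ s)
    refine (hasDerivAt_matrix_mulVec (hZ s) h1).congr_deriv ?_
    rw [Matrix.mulVec_mulVec, Matrix.neg_mulVec, neg_add_cancel]
  have := is_const_of_deriv_eq_zero (fun s => (hder s).differentiableAt)
    (fun s => (hder s).deriv) t 0
  simp only [hZ0, Matrix.one_mulVec] at this
  rw [← this, Matrix.mulVec_mulVec, hΦZ, Matrix.one_mulVec]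

theorem lemma2p2 {m n : ℕ} (hn : 2 ≤ n)
    (E : Matrix (Fin m) (Fin m) ℝ)
    (F : (Fin m → ℝ) → (Fin m → ℝ)) (hF : ContDiff ℝ 1 F)
    -- a periodic solution of the kinetic system, with minimum period `p`
    (φ : ℝ → Fin m → ℝ) (hφ : ∀ t, HasDerivAt φ (F (φ t)) t)
    (p : ℝ) (hp : IsMinPeriod φ p)
    -- one Floquet multiplier of `φ` is `1`, all the others have modulus less than one
    (hH : ∃ M : Multiset ℂ,
      HasFloquetMultipliers (fun t => jacobian F (φ t)) p (1 ::ₘ M) ∧ ∀ μ ∈ M, ‖μ‖ < 1)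
    -- the bifurcating periodic solutions and their period function
    (ε₀ : ℝ) (ψ : ℝ → ℝ → Fin m → ℝ) (P : ℝ → ℝ)
    (hψ : IsBifurcatingFamily E F φ ε₀ ψ P) :
    DifferentiableAt ℝ P 0 ∧
    ∃ δ₀ > 0, ∃ C : ℝ, ∃ r > 0, ∃ (γ : Fin n → ℝ → ℂ) (rest : ℝ → Multiset ℂ),
      ∀ δ : ℝ, 0 ≤ δ → δ < δ₀ →
        HasFloquetMultipliers (patchLinearization n E F φ δ) p
          (Finset.univ.val.map (fun j => γ j δ) + rest δ) ∧
        (∀ μ ∈ rest δ, r ≤ ‖μ - 1‖) ∧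
        (∀ j : Fin n, (j : ℕ) = 0 → γ j δ = 1) ∧
        (∀ j : Fin n, (j : ℕ) ≠ 0 →
          ‖γ j δ - (1 - (n : ℂ) * (deriv P 0 : ℝ) * (δ : ℂ))‖ ≤ C * δ ^ 2) := by
  obtain ⟨M, ⟨Φ, hΦ, hroots⟩, hM⟩ := hH
  have hn0 : n ≠ 0 := by omega
  have hnpos : (0 : ℝ) < n := by positivity
  have hFd : Differentiable ℝ F := hF.differentiable one_ne_zero
  have hφc : Continuous φ := continuous_iff_continuousAt.2 fun t => (hφ t).continuousAt
  have hper : φ p = φ 0 := by simpa using hp.1.2 0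
  obtain ⟨Z, hZΦ, hZ⟩ := hΦ.exists_inverse ((continuous_jacobian hF).comp hφc)
  have hΦZ : ∀ t, Φ t * Z t = 1 := fun t => mul_eq_one_comm.1 (hZΦ t)
  have hZ0 : Z 0 = 1 := by simpa [hΦ.1] using hZΦ 0
  have hvel := velocity_eq_mulVec hFd hφ hZ0 hΦZ hZ
  have hv0 := velocity_ne_zero_of_isMinPeriod hφ hp hvel
  have hAv : Φ p *ᵥ F (φ 0) = (1 : ℝ) • F (φ 0) := by rw [← hvel, hper, one_smul]
  have hmult : (Φ p).charpoly.rootMultiplicity 1 = 1 := by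
    rw [Polynomial.eq_rootMultiplicity_map (algebraMap ℝ ℂ).injective, ← Matrix.charpoly_map,
      ← Polynomial.count_roots, hroots, map_one, Multiset.count_cons_self,
      Multiset.count_eq_zero_of_notMem fun h => by simpa using hM 1 h]
  obtain ⟨w, hwv, hwA, hN, hinj⟩ := exists_left_eigenvector_of_rootMultiplicity_eq_one hmult hv0 hAv
  obtain ⟨Ψ, D, hΨ, hD0, hD, hexp⟩ := hΦ.exists_perturbation hZΦ (continuous_of_hasDerivAt_apply hZ) E
  obtain ⟨C, hC⟩ := hexp p
  have hdet : (Matrix.scalar (Fin m) (1 : ℝ) - Φ p).det = 0 := by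
    rw [← Matrix.eval_charpoly]
    exact (Polynomial.rootMultiplicity_pos (Matrix.charpoly_monic _).ne_zero).1 (by omega)
  have hz₁ : ∀ t, HasDerivAt (fun t => D t *ᵥ F (φ 0)) (-(Z t *ᵥ (E *ᵥ F (φ t)))) t := fun t => by
    refine (hasDerivAt_matrix_mulVec (hD t) (hasDerivAt_const t (F (φ 0)))).congr_deriv ?_
    rw [Matrix.mulVec_zero, add_zero, Matrix.neg_mulVec, ← Matrix.mulVec_mulVec, ← hvel,
      Matrix.mulVec_mulVec]
  have hPd := hψ.hasDerivAt_period hF hφ hp hwv (by simpa using hwA) (by simpa using hinj)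
    fun θ hθ => exists_norm_closing_le hF hφ hp.1.1 hper hZ0 (hΦZ p) hZ
      (z₁ := fun t => D t *ᵥ F (φ 0)) (by simp [hD0]) hz₁ hθ
  rw [Matrix.mulVec_mulVec] at hPd
  obtain ⟨η₀, hη₀, K, r₁, hr₁, heig⟩ := exists_eigenvalue_expansion hC hN hwv hdet
  obtain ⟨r₂, hr₂, hMr⟩ := Multiset.exists_pos_le_norm_sub_one hM
  -- The same quotient is minus the derivative of the period and the first-order coefficient of the
  -- eigenvalue.
  set c := (w ⬝ᵥ ((Φ p * D p) *ᵥ F (φ 0))) / (w ⬝ᵥ F (φ 0)) with hc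
  -- Values outside `|η| < η₀` are irrelevant; zero fills them so that choice gives total functions.
  have heig' : ∀ η, ∃ (γ : ℂ) (rest : Multiset ℂ), |η| < η₀ →
      ((Ψ η p).map (algebraMap ℝ ℂ)).charpoly.roots = γ ::ₘ rest ∧
      ‖γ - (1 + c * η : ℝ)‖ ≤ K * η ^ 2 ∧ ∀ μ ∈ rest, r₁ ≤ ‖μ - (1 : ℝ)‖ := fun η => by
    by_cases h : |η| < η₀
    · obtain ⟨γ, rest, h'⟩ := heig η h
      exact ⟨γ, rest, fun _ => h'⟩
    · exact ⟨0, 0, fun h' => absurd h' h⟩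
  choose γ rest hγ using heig'
  -- The parameter is `η = n δ`: the eigenvalue expansion needs `|η| < η₀`, the Dyson series needs
  -- `|η| ≤ 1`, and `K η²` becomes `K n² δ²`. The unperturbed block supplies the exact multiplier 1
  -- and `M`.
  refine ⟨hPd.differentiableAt, min η₀ 1 / n, by positivity, K * n ^ 2, min r₁ r₂, lt_min hr₁ hr₂,
    fun j δ => if (j : ℕ) = 0 then 1 else γ (n * δ), fun δ => M + (n - 1) • rest (n * δ),
    fun δ hδ hδ₀ => ?_⟩
  have hnδ : |n * δ| < min η₀ 1 := by
    rw [abs_of_nonneg (by positivity), mul_comm]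
    exact (lt_div_iff₀ hnpos).1 hδ₀
  obtain ⟨h1, h2, h3⟩ := hγ (n * δ) (hnδ.trans_le (min_le_left _ _))
  refine ⟨?_, fun μ hμ => ?_, fun j hj => if_pos hj, fun j hj => ?_⟩
  · have := hasFloquetMultipliers_patchLinearization (p := p) hn0 hFd hΦ
      (hΨ (n * δ) (hnδ.le.trans (min_le_right _ _)))
    rw [hroots, h1] at this
    beta_reduce
    rw [Fin.univ_val_map_ite hn0]
    convert this using 1
    rw [← Multiset.singleton_add (γ (n * δ)), nsmul_add, ← Multiset.singleton_add,
      ← Multiset.singleton_add (1 : ℂ) M]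
    abel
  · rcases Multiset.mem_add.1 hμ with h | h
    · exact (min_le_right _ _).trans (hMr μ h)
    · have := h3 μ (Multiset.mem_of_mem_nsmul h)
      rw [Complex.ofReal_one] at this
      exact (min_le_left _ _).trans this
  · simp only [if_neg hj]
    rw [hPd.deriv]
    have h4 : (1 - (n : ℂ) * ((-c : ℝ) : ℂ) * (δ : ℂ)) = ((1 + c * (n * δ) : ℝ) : ℂ) := by
      push_cast; ring
    rw [h4]
    calc _ ≤ K * (n * δ) ^ 2 := h2
      _ = _ := by ring
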